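/- **Setting.** Let $\mathcal C$ be a braided monoidal category (taken strict in the notation) with tensor product $\otimes$, unit $K$ and braid $c$, in which idempotents split; an object also denotes its identity morphism. A unital magma is a triple $(A,\eta_A,\mu_A)$ with $\mu_A\circ(\eta_A\otimes A)=id_A=\mu_A\circ(A\otimes\eta_A)$ (no associativity). For a comonoid $D$ and a unital magma $A$, put $f*g=\mu_A\circ(f\otimes g)\circ\delta_D$ for $f,g:D\to A$. *Weak Hopf quasigroups.* A weak Hopf quasigroup is a unital magma $(H,\eta_H,\mu_H)$ that is also a comonoid $(H,\varepsilon_H,\delta_H)$, with a morphism $\lambda_H:H\to H$ such that, with $\Pi^L_H=id_H*\lambda_H$ and $\Pi^R_H=\lambda_H*id_H$, * $\delta_H\circ\mu_H=(\mu_H\otimes\mu_H)\circ(H\otimes c_{H,H}\otimes H)\circ(\delta_H\otimes\delta_H)$; * $\varepsilon_H\circ\mu_H\circ(\mu_H\otimes H)=\varepsilon_H\circ\mu_H\circ(H\otimes\mu_H)=((\varepsilon_H\circ\mu_H)\otimes(\varepsilon_H\circ\mu_H))\circ(H\otimes\delta_H\otimes H)=((\varepsilon_H\circ\mu_H)\otimes(\varepsilon_H\circ\mu_H))\circ(H\otimes(c_{H,H}^{-1}\circ\delta_H)\otimes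 H)$; * $(\delta_H\otimes H)\circ\delta_H\circ\eta_H=(H\otimes\mu_H\otimes H)\circ((\delta_H\circ\eta_H)\otimes(\delta_H\circ\eta_H))=(H\otimes(\mu_H\circ c_{H,H}^{-1})\otimes H)\circ((\delta_H\circ\eta_H)\otimes(\delta_H\circ\eta_H))$; * $\Pi^L_H=((\varepsilon_H\circ\mu_H)\otimes H)\circ(H\otimes c_{H,H})\circ((\delta_H\circ\eta_H)\otimes H)$ and $\Pi^R_H=(H\otimes(\varepsilon_H\circ\mu_H))\circ(c_{H,H}\otimes H)\circ(H\otimes(\delta_H\circ\eta_H))$; * $\lambda_H*\Pi^L_H=\Pi^R_H*\lambda_H=\lambda_H$; * $\mu_H\circ(\lambda_H\otimes\mu_H)\circ(\delta_H\otimes H)=\mu_H\circ(\Pi^R_H\otimes H)$ and $\mu_H\circ(H\otimes\mu_H)\circ(H\otimes\lambda_H\otimes H)\circ(\delta_H\otimes H)=\mu_H\circ(\Pi^L_H\otimes H)$; * $\mu_H\circ(\mu_H\otimes\lambda_H)\circ(H\otimes\delta_H)=\mu_H\circ(H\otimes\Pi^L_H)$ and $\mu_H\circ(\mu_H\otimes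 H)\circ(H\otimes\lambda_H\otimes H)\circ(H\otimes\delta_H)=\mu_H\circ(H\otimes\Pi^R_H)$. *Comodule magmas.* A right $H$-comodule magma is a unital magma $B$ with a right $H$-comodule structure $\rho_B:B\to B\otimes H$ such that $\rho_B\circ\mu_B=(\mu_B\otimes\mu_H)\circ(B\otimes c_{H,B}\otimes H)\circ(\rho_B\otimes\rho_B)$ and, with $\overline\Pi^R_H=((\varepsilon_H\circ\mu_H)\otimes H)\circ(H\otimes(\delta_H\circ\eta_H))$, any one of the following (equivalent) conditions holds: * $(\rho_B\otimes H)\circ\rho_B\circ\eta_B=(B\otimes(\mu_H\circ c_{H,H}^{-1})\otimes H)\circ((\rho_B\circ\eta_B)\otimes(\delta_H\circ\eta_H))$; * $(\rho_B\otimes H)\circ\rho_B\circ\eta_B=(B\otimes\mu_H\otimes H)\circ((\rho_B\circ\eta_B)\otimes(\delta_H\circ\eta_H))$; * $(B\otimes\overline\Pi^R_H)\circ\rho_B=(\mu_B\otimes H)\circ(B\otimes(\rho_B\circ\eta_B))$; * $(B\otimes\Pi^L_H)\circ\rho_B=((\mu_B\circ c_{B,B}^{-1})\otimes H)\circ(B\otimes(\rho_B\circ\eta_B))$;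 * $(B\otimes\overline\Pi^R_H)\circ\rho_B\circ\eta_B=\rho_B\circ\eta_B$; * $(B\otimes\Pi^L_H)\circ\rho_B\circ\eta_B=\rho_B\circ\eta_B$. *Anchor morphisms.* An anchor morphism $h:H\to B$ is a morphism of right $H$-comodules and of unital magmas such that $$\mu_B\circ((\mu_B\circ(B\otimes h))\otimes(h\circ\lambda_H))\circ(B\otimes\delta_H)=\mu_B\circ(B\otimes(h\circ\Pi^L_H)),$$ $$\mu_B\circ((\mu_B\circ(B\otimes(h\circ\lambda_H)))\otimes h)\circ(B\otimes\delta_H)=\mu_B\circ(B\otimes(h\circ\Pi^R_H)).$$ Let $q_B=\mu_B\circ(B\otimes(h\circ\lambda_H))\circ\rho_B$. It is idempotent; write $q_B=i_B\circ p_B$ with $p_B\circ i_B=id_{B^{coH}}$. *Strong Hopf modules.* A strong $(H,B,h)$-Hopf module is a right $H$-comodule $(M,\rho_M)$ with a morphism $\phi_M:M\otimes B\to M$ such that * $\phi_M\circ(M\otimes\eta_B)=id_M$; * $\phi_M\circ((\phi_M\circ(M\otimes i_B))\otimes B)=\phi_M\circ(M\otimes(\mu_B\circ(i_B\otimes B)))$;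 * $\rho_M\circ\phi_M=(\phi_M\otimes\mu_H)\circ(M\otimes c_{H,B}\otimes H)\circ(\rho_M\otimes\rho_B)$; * $\phi_M\circ((\phi_M\circ(M\otimes h))\otimes(h\circ\lambda_H))\circ(M\otimes\delta_H)=\phi_M\circ(M\otimes(h\circ\Pi^L_H))$; * $\phi_M\circ((\phi_M\circ(M\otimes(h\circ\lambda_H)))\otimes h)\circ(M\otimes\delta_H)=\phi_M\circ(M\otimes(h\circ\Pi^R_H))$. Let $q_M=\phi_M\circ(M\otimes(h\circ\lambda_H))\circ\rho_M$. It is idempotent; write $q_M=i_M\circ p_M$ with $p_M\circ i_M=id_{M^{coH}}$, and let $\phi_{M^{coH}}=p_M\circ\phi_M\circ(i_M\otimes i_B)$. **Theorem (Fundamental Theorem of Hopf modules).** Let $H$ be a weak Hopf quasigroup, $B$ a right $H$-comodule magma and $h:H\to B$ an anchor morphism. Assume that $\mathcal C$ has coequalizers and that $-\otimes B$ and $-\otimes H$ preserve them. Then $q_B$ is idempotent. Assume moreover that $$\mu_B\circ((\mu_B\circ(B\otimes i_B))\otimes B)=\mu_B\circ(B\otimes(\mu_B\circ(i_B\otimes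 B))),\qquad \mu_B\circ(i_B\otimes\mu_B)=\mu_B\circ((\mu_B\circ(i_B\otimes B))\otimes B).$$ Let $M$ be a strong $(H,B,h)$-Hopf module. Then: 1. $q_M$ is idempotent and $i_M\circ\phi_{M^{coH}}=\phi_M\circ(i_M\otimes i_B)$. Let $n_M:M^{coH}\otimes B\to M^{coH}\otimes_{B^{coH}}B$ be the coequalizer of $\phi_{M^{coH}}\otimes B$ and $M^{coH}\otimes(\mu_B\circ(i_B\otimes B))$. There are a unique action $\phi$ and a unique coaction $\rho$ on $M^{coH}\otimes_{B^{coH}}B$ with $\phi\circ(n_M\otimes B)=n_M\circ(M^{coH}\otimes\mu_B)$ and $\rho\circ n_M=(n_M\otimes H)\circ(M^{coH}\otimes\rho_B)$, and with these it is a strong $(H,B,h)$-Hopf module. 2. The morphism $\omega_M:M^{coH}\otimes_{B^{coH}}B\to M$ determined by $\omega_M\circ n_M=\phi_M\circ(i_M\otimes B)$ exists and is an isomorphism, and $\phi_M^{\omega_M}=\omega_M\circ\phi\circ(\omega_M^{-1}\otimes B)$ does not depend on the choices made. Hence one has the category $\mathcal{SM}^H_B(h)$ of strong $(H,B,h)$-Hopf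 modules, whose morphisms $f:M\to N$ are the right $H$-comodule morphisms with $\phi_N^{\omega_N}\circ(f\otimes B)=f\circ\phi_M^{\omega_M}$. 3. The objects $(M^{coH}\otimes_{B^{coH}}B,\phi,\rho)$ and $(M,\phi_M,\rho_M)$ are isomorphic in $\mathcal{SM}^H_B(h)$. -/

import Mathlib

open CategoryTheory MonoidalCategory Limits

universe v u

namespace WeakHopf

section Basic

variable {C : Type u} [Category.{v} C] [MonoidalCategory C]

/-- A unital magma in a monoidal category: a unit and a product, not assumed associative. -/
class UnitalMagmaObj (A : C) where
  one : 𝟙_ C ⟶ A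
  mul : A ⊗ A ⟶ A
  one_mul : one ▷ A ≫ mul = (λ_ A).hom
  mul_one : A ◁ one ≫ mul = (ρ_ A).hom

/-- The unit of a unital magma. -/
abbrev η (A : C) [UnitalMagmaObj A] : 𝟙_ C ⟶ A := UnitalMagmaObj.one

/-- The product of a unital magma. -/
abbrev μ (A : C) [UnitalMagmaObj A] : A ⊗ A ⟶ A := UnitalMagmaObj.mul

/-- The counit of a comonoid. -/
abbrev ε (D : C) [ComonObj D] : D ⟶ 𝟙_ C := ComonObj.counit

/-- The coproduct of a comonoid. -/
abbrev δ (D : C) [ComonObj D] : D ⟶ D ⊗ D := ComonObj.comul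

/-- The convolution product `f ∗ g = μ ∘ (f ⊗ g) ∘ δ`. -/
def conv {D A : C} [ComonObj D] [UnitalMagmaObj A] (f g : D ⟶ A) : D ⟶ A :=
  δ D ≫ (f ⊗ₘ g) ≫ μ A

/-- `(M, ρ)` is a right comodule over the comonoid `D`. -/
structure IsRightComodule (D : C) [ComonObj D] {M : C} (ρ : M ⟶ M ⊗ D) : Prop where
  counit : ρ ≫ M ◁ ε D = (ρ_ M).inv
  coassoc : ρ ≫ ρ ▷ D = ρ ≫ M ◁ δ D ≫ (α_ M D D).inv

/-- A factorization `q = i ∘ p`, `p ∘ i = id` of an (automatically idempotent) endomorphism `q`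
through an object `Z`, the image of `q`. -/
structure Splitting {Y : C} (q : Y ⟶ Y) where
  Z : C
  p : Y ⟶ Z
  i : Z ⟶ Y
  p_i : p ≫ i = q
  i_p : i ≫ p = 𝟙 Z

end Basic

section WeakHopfQuasigroup

variable {C : Type u} [Category.{v} C] [MonoidalCategory C] [BraidedCategory C]

/-- A weak Hopf quasigroup in a braided monoidal category. Constraints of the monoidal structure
are inserted explicitly or by `⊗≫`. The target and source morphisms are `id ∗ λ` and `λ ∗ id`. -/
class WeakHopfQuasigroup (H : C) extends UnitalMagmaObj H, ComonObj H where
  mul_comul : μ H ≫ δ H = (δ H ⊗ₘ δ H) ≫ tensorμ H H H H ≫ (μ H ⊗ₘ μ H)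
  counit_mul_assoc :
    μ H ▷ H ≫ μ H ≫ ε H = (α_ H H H).hom ≫ H ◁ μ H ≫ μ H ≫ ε H
  counit_mul_mul :
    μ H ▷ H ≫ μ H ≫ ε H =
      (H ◁ δ H) ▷ H ⊗≫ ((μ H ≫ ε H) ⊗ₘ (μ H ≫ ε H)) ≫ (λ_ (𝟙_ C)).hom
  counit_mul_mul' :
    μ H ▷ H ≫ μ H ≫ ε H =
      (H ◁ (δ H ≫ (β_ H H).inv)) ▷ H ⊗≫ ((μ H ≫ ε H) ⊗ₘ (μ H ≫ ε H)) ≫ (λ_ (𝟙_ C)).hom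
  one_comul_comul :
    η H ≫ δ H ≫ δ H ▷ H =
      (λ_ (𝟙_ C)).inv ≫ ((η H ≫ δ H) ⊗ₘ (η H ≫ δ H)) ⊗≫ (H ◁ μ H) ▷ H
  one_comul_comul' :
    η H ≫ δ H ≫ δ H ▷ H =
      (λ_ (𝟙_ C)).inv ≫ ((η H ≫ δ H) ⊗ₘ (η H ≫ δ H)) ⊗≫ (H ◁ ((β_ H H).inv ≫ μ H)) ▷ H
  /-- The antipode. -/
  antipode : H ⟶ H
  target_eq :
    conv (𝟙 H) antipode =
      (λ_ H).inv ≫ (η H ≫ δ H) ▷ H ≫ (α_ H H H).hom ≫ H ◁ (β_ H H).hom ≫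
        (α_ H H H).inv ≫ (μ H ≫ ε H) ▷ H ≫ (λ_ H).hom
  source_eq :
    conv antipode (𝟙 H) =
      (ρ_ H).inv ≫ H ◁ (η H ≫ δ H) ≫ (α_ H H H).inv ≫ (β_ H H).hom ▷ H ≫
        (α_ H H H).hom ≫ H ◁ (μ H ≫ ε H) ≫ (ρ_ H).hom
  antipode_target : conv antipode (conv (𝟙 H) antipode) = antipode
  source_antipode : conv (conv antipode (𝟙 H)) antipode = antipode
  antipode_mul_left :
    δ H ▷ H ≫ (α_ H H H).hom ≫ (antipode ⊗ₘ μ H) ≫ μ H = conv antipode (𝟙 H) ▷ H ≫ μ H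
  mul_antipode_left :
    δ H ▷ H ≫ (α_ H H H).hom ≫ H ◁ (antipode ▷ H) ≫ H ◁ μ H ≫ μ H =
      conv (𝟙 H) antipode ▷ H ≫ μ H
  mul_antipode_right :
    H ◁ δ H ≫ (α_ H H H).inv ≫ (μ H ⊗ₘ antipode) ≫ μ H = H ◁ conv (𝟙 H) antipode ≫ μ H
  antipode_mul_right :
    H ◁ δ H ≫ (α_ H H H).inv ≫ (H ◁ antipode) ▷ H ≫ μ H ▷ H ≫ μ H =
      H ◁ conv antipode (𝟙 H) ≫ μ H

/-- The antipode `λ_H`. -/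
abbrev anti (H : C) [WeakHopfQuasigroup H] : H ⟶ H := WeakHopfQuasigroup.antipode

/-- The target morphism `Π^L = id ∗ λ`. -/
def PiL (H : C) [WeakHopfQuasigroup H] : H ⟶ H := conv (𝟙 H) (anti H)

/-- The source morphism `Π^R = λ ∗ id`. -/
def PiR (H : C) [WeakHopfQuasigroup H] : H ⟶ H := conv (anti H) (𝟙 H)

/-- The morphism `Π̄^R = ((ε ∘ μ) ⊗ H) ∘ (H ⊗ (δ ∘ η))`. -/
def PiRBar (H : C) [WeakHopfQuasigroup H] : H ⟶ H :=
  (ρ_ H).inv ≫ H ◁ (η H ≫ δ H) ≫ (α_ H H H).inv ≫ (μ H ≫ ε H) ▷ H ≫ (λ_ H).hom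

/-- A right `H`-comodule magma: a unital magma with a multiplicative right `H`-coaction that
satisfies any one of the six usual (equivalent) compatibility conditions with the units. -/
class ComoduleMagma (H : C) [WeakHopfQuasigroup H] (B : C) extends UnitalMagmaObj B where
  coact : B ⟶ B ⊗ H
  isComodule : IsRightComodule H coact
  mul_coact : μ B ≫ coact = (coact ⊗ₘ coact) ≫ tensorμ B H B H ≫ (μ B ⊗ₘ μ H)
  unit_coact :
    (η B ≫ coact ≫ coact ▷ H =
      (λ_ (𝟙_ C)).inv ≫ ((η B ≫ coact) ⊗ₘ (η H ≫ δ H)) ⊗≫ (B ◁ ((β_ H H).inv ≫ μ H)) ▷ H) ∨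
    (η B ≫ coact ≫ coact ▷ H =
      (λ_ (𝟙_ C)).inv ≫ ((η B ≫ coact) ⊗ₘ (η H ≫ δ H)) ⊗≫ (B ◁ μ H) ▷ H) ∨
    (coact ≫ B ◁ PiRBar H =
      (ρ_ B).inv ≫ B ◁ (η B ≫ coact) ≫ (α_ B B H).inv ≫ μ B ▷ H) ∨
    (coact ≫ B ◁ PiL H =
      (ρ_ B).inv ≫ B ◁ (η B ≫ coact) ≫ (α_ B B H).inv ≫ ((β_ B B).inv ≫ μ B) ▷ H) ∨
    (η B ≫ coact ≫ B ◁ PiRBar H = η B ≫ coact) ∨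
    (η B ≫ coact ≫ B ◁ PiL H = η B ≫ coact)

/-- The coaction of a right `H`-comodule magma. -/
abbrev coactB (H : C) [WeakHopfQuasigroup H] (B : C) [ComoduleMagma H B] : B ⟶ B ⊗ H :=
  ComoduleMagma.coact

/-- An anchor morphism `h : H ⟶ B`: a morphism of right `H`-comodules and of unital magmas that
satisfies the two cancellation conditions below. -/
structure IsAnchor {H : C} [WeakHopfQuasigroup H] {B : C} [ComoduleMagma H B] (h : H ⟶ B) :
    Prop where
  colinear : h ≫ coactB H B = δ H ≫ h ▷ H
  map_one : η H ≫ h = η B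
  map_mul : μ H ≫ h = (h ⊗ₘ h) ≫ μ B
  cancel_left :
    B ◁ δ H ≫ (α_ B H H).inv ≫ ((B ◁ h ≫ μ B) ⊗ₘ (anti H ≫ h)) ≫ μ B =
      B ◁ (PiL H ≫ h) ≫ μ B
  cancel_right :
    B ◁ δ H ≫ (α_ B H H).inv ≫ ((B ◁ (anti H ≫ h) ≫ μ B) ⊗ₘ h) ≫ μ B =
      B ◁ (PiR H ≫ h) ≫ μ B

/-- The endomorphism `q_M = φ ∘ (M ⊗ (h ∘ λ)) ∘ ρ` of an object `M` with an action `φ` of `B` and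
a coaction `ρ` of `H`. Its image is the object of coinvariants. -/
def coinvEndo {H : C} [WeakHopfQuasigroup H] {B : C} (h : H ⟶ B) {M : C}
    (φ : M ⊗ B ⟶ M) (ρ : M ⟶ M ⊗ H) : M ⟶ M :=
  ρ ≫ M ◁ (anti H ≫ h) ≫ φ

/-- The endomorphism `q_B = μ ∘ (B ⊗ (h ∘ λ)) ∘ ρ` of `B`. -/
abbrev qB {H : C} [WeakHopfQuasigroup H] {B : C} [ComoduleMagma H B] (h : H ⟶ B) : B ⟶ B :=
  coinvEndo h (μ B) (coactB H B)

/-- `(x i(b)) y = x (i(b) y)` for the inclusion `i` of the coinvariants of `B`. -/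
def StrongOne {B : C} [UnitalMagmaObj B] {Z : C} (i : Z ⟶ B) : Prop :=
  (B ◁ i ≫ μ B) ▷ B ≫ μ B = (α_ B Z B).hom ≫ B ◁ (i ▷ B ≫ μ B) ≫ μ B

/-- `i(b) (x y) = (i(b) x) y` for the inclusion `i` of the coinvariants of `B`. -/
def StrongTwo {B : C} [UnitalMagmaObj B] {Z : C} (i : Z ⟶ B) : Prop :=
  (i ⊗ₘ μ B) ≫ μ B = (α_ Z B B).inv ≫ (i ▷ B ≫ μ B) ▷ B ≫ μ B

/-- `(M, φ, ρ)` is a strong `(H, B, h)`-Hopf module, where `i` is the inclusion of the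
coinvariants of `B`. -/
structure IsStrongHopfModule {H : C} [WeakHopfQuasigroup H] {B : C} [ComoduleMagma H B]
    (h : H ⟶ B) {Z : C} (i : Z ⟶ B) {M : C} (φ : M ⊗ B ⟶ M) (ρ : M ⟶ M ⊗ H) : Prop where
  isComodule : IsRightComodule H ρ
  act_one : M ◁ η B ≫ φ = (ρ_ M).hom
  act_act : (M ◁ i ≫ φ) ▷ B ≫ φ = (α_ M Z B).hom ≫ M ◁ (i ▷ B ≫ μ B) ≫ φ
  act_coact : φ ≫ ρ = (ρ ⊗ₘ coactB H B) ≫ tensorμ M H B H ≫ (φ ⊗ₘ μ H)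
  cancel_left :
    M ◁ δ H ≫ (α_ M H H).inv ≫ ((M ◁ h ≫ φ) ⊗ₘ (anti H ≫ h)) ≫ φ = M ◁ (PiL H ≫ h) ≫ φ
  cancel_right :
    M ◁ δ H ≫ (α_ M H H).inv ≫ ((M ◁ (anti H ≫ h) ≫ φ) ⊗ₘ h) ≫ φ = M ◁ (PiR H ≫ h) ≫ φ

/-- Strong `(H, B, h)`-Hopf modules, relative to a splitting `sB` of `q_B` whose image is the
object of coinvariants of `B`. -/
structure StrongHopfModule {H : C} [WeakHopfQuasigroup H] {B : C} [ComoduleMagma H B]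
    (h : H ⟶ B) (sB : Splitting (qB h)) where
  X : C
  act : X ⊗ B ⟶ X
  coact : X ⟶ X ⊗ H
  isStrong : IsStrongHopfModule h sB.i act coact

namespace StrongHopfModule

variable {H : C} [WeakHopfQuasigroup H] {B : C} [ComoduleMagma H B] {h : H ⟶ B}
  {sB : Splitting (qB h)} (M : StrongHopfModule h sB)

/-- The endomorphism `q_M`. -/
abbrev q : M.X ⟶ M.X := coinvEndo h M.act M.coact

section Tensor

variable {M}
variable (sM : Splitting M.q)

/-- The action `p_M ∘ φ_M ∘ (i_M ⊗ i_B)` of the coinvariants of `B` on those of `M`. -/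
def coinvAct : sM.Z ⊗ sB.Z ⟶ sM.Z := (sM.i ⊗ₘ sB.i) ≫ M.act ≫ sM.p

/-- `T¹ = φ_{M^{coH}} ⊗ B`. -/
def T₁ : (sM.Z ⊗ sB.Z) ⊗ B ⟶ sM.Z ⊗ B := coinvAct sM ▷ B

/-- `T² = M^{coH} ⊗ (μ_B ∘ (i_B ⊗ B))`. -/
def T₂ : (sM.Z ⊗ sB.Z) ⊗ B ⟶ sM.Z ⊗ B :=
  (α_ sM.Z sB.Z B).hom ≫ sM.Z ◁ (sB.i ▷ B ≫ μ B)

variable [HasCoequalizers C]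

/-- The object `M^{coH} ⊗_{B^{coH}} B`, the coequalizer of `T¹` and `T²`. -/
noncomputable def tensorObj : C := coequalizer (T₁ sM) (T₂ sM)

/-- The coequalizer morphism `n : M^{coH} ⊗ B ⟶ M^{coH} ⊗_{B^{coH}} B`. -/
noncomputable def n : sM.Z ⊗ B ⟶ tensorObj sM := coequalizer.π (T₁ sM) (T₂ sM)

/-- `φ` is the action on `M^{coH} ⊗_{B^{coH}} B` induced by the product of `B`. -/
def IsInducedAction (φ : tensorObj sM ⊗ B ⟶ tensorObj sM) : Prop :=
  n sM ▷ B ≫ φ = (α_ sM.Z B B).hom ≫ sM.Z ◁ μ B ≫ n sM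

/-- `ρ` is the coaction on `M^{coH} ⊗_{B^{coH}} B` induced by the coaction of `B`. -/
def IsInducedCoaction (ρ : tensorObj sM ⟶ tensorObj sM ⊗ H) : Prop :=
  n sM ≫ ρ = sM.Z ◁ coactB H B ≫ (α_ sM.Z B H).inv ≫ n sM ▷ H

end Tensor

variable [HasCoequalizers C]

/-- `ψ` is the deformed action `φ_M^ω = ω ∘ φ ∘ (ω⁻¹ ⊗ B)` on `M`, where `φ` is the induced action
on `M^{coH} ⊗_{B^{coH}} B` and `ω` is the isomorphism from `M^{coH} ⊗_{B^{coH}} B` to `M`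
determined by `ω ∘ n = φ_M ∘ (i_M ⊗ B)`. -/
def IsDeformedAction (ψ : M.X ⊗ B ⟶ M.X) : Prop :=
  ∃ (sM : Splitting M.q) (φ : tensorObj sM ⊗ B ⟶ tensorObj sM) (ω : tensorObj sM ≅ M.X),
    IsInducedAction sM φ ∧ n sM ≫ ω.hom = sM.i ▷ B ≫ M.act ∧
      ψ = ω.inv ▷ B ≫ φ ≫ ω.hom

open Classical in
/-- The deformed action `φ_M^ω`. (The default value is never used under the hypotheses of the
fundamental theorem, whose conclusion includes that there is exactly one deformed action.) -/
noncomputable def deformedAct : M.X ⊗ B ⟶ M.X :=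
  if hψ : ∃ ψ, M.IsDeformedAction ψ then hψ.choose else M.act

/-- Morphisms of strong Hopf modules: `H`-colinear and `B`-quasilinear morphisms. -/
@[ext]
structure Hom (M N : StrongHopfModule h sB) where
  hom : M.X ⟶ N.X
  colinear : M.coact ≫ hom ▷ H = hom ≫ N.coact
  quasilinear : hom ▷ B ≫ N.deformedAct = M.deformedAct ≫ hom

/-- The category of strong `(H, B, h)`-Hopf modules. -/
noncomputable instance : Category (StrongHopfModule h sB) where
  Hom M N := Hom M N
  id M := ⟨𝟙 M.X, by simp, by simp⟩
  comp f g := ⟨f.hom ≫ g.hom,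
    by rw [comp_whiskerRight, ← Category.assoc, f.colinear, Category.assoc, g.colinear,
      Category.assoc],
    by rw [comp_whiskerRight, Category.assoc, g.quasilinear, ← Category.assoc, f.quasilinear,
      Category.assoc]⟩
  id_comp f := Hom.ext (Category.id_comp f.hom)
  comp_id f := Hom.ext (Category.comp_id f.hom)
  assoc f g k := Hom.ext (Category.assoc f.hom g.hom k.hom)

end StrongHopfModule

end WeakHopfQuasigroup

end WeakHopf

/-! Write `x₀ ⊗ x₁` for a coaction and `q(x) = x₀ hλ(x₁)`. As for ordinary Hopf modules, the inverse
of `m ⊗ b ↦ m b` is `x ↦ p(x₀) ⊗ h(x₁)`. Two facts make this work without general associativity: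
every element is recovered as `q(x₀) h(x₁) = x` (`op_coinvEndo_act`), and `ρ(m b) = m b₀ ⊗ b₁` for
coinvariant `m` (`op_coinvEndo_act_coact`).

The first follows from the second cancellation law and `x₀ hΠ^R(x₁) = x`. The second usually rests
on the antipode reversing coproducts. Here it comes from the identity `b₁ ⊗ y b₂ = λ(y₁)(y₂ b)₁ ⊗
(y₂ b)₂` (`op_mulSnd_eq`). Applied to `b = λ(y')`, it expresses `ρ(q(x))` through `δ(Π^L)`, so that
the `H`-leg lies in the image of `Π̄^R` (`coinvCoact_PiRBar`). Since `Π̄^R(z) c = ε(z c₁) c₂`, the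
factor `m₁` in `ρ(m b) = m₀ b₀ ⊗ m₁ b₁` is then absorbed by the counit.

Idempotency of `q` follows by taking `b = 1`. Writing `b = q(b₀) h(b₁)` and using that elements of
`B` reassociate around coinvariants gives `q(m b) = m q(b)` (`op_coinvEndo_act_coinvEndo`). Over the
coequalizer this yields `p(m b₀) ⊗ h(b₁) = m ⊗ q(b₀) h(b₁) = m ⊗ b`, which is invertibility
(`exists_omega`).

All induced structures are checked after composing with `n`, which stays epi after the tensorings
that occur. The deformed action has the closed form `x ⊗ b ↦ q(x₀)(h(x₁) b)`, hence is independent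
of choices. On the tensor product it is the induced action itself, so the isomorphism respects both
structures. -/

namespace WeakHopf

/-! ### Strictified string-diagram calculus -/

section Operations

variable {C : Type u} [Category.{v} C] [MonoidalCategory C]

/-! Morphisms acting on the leading factors of a right-nested tensor product. They make diagrams
strict: the only structural law left is the exchange law, oriented so that operations further to
the left come first. -/

/-- A morphism from two factors to two factors, in front of `W`. -/
def op22 {X Y Z T : C} (f : X ⊗ Y ⟶ Z ⊗ T) (W : C) : X ⊗ Y ⊗ W ⟶ Z ⊗ T ⊗ W :=
  (α_ X Y W).inv ≫ f ▷ W ≫ (α_ Z T W).hom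

/-- A morphism from two factors to one factor, in front of `W`. -/
def op21 {X Y Z : C} (f : X ⊗ Y ⟶ Z) (W : C) : X ⊗ Y ⊗ W ⟶ Z ⊗ W :=
  (α_ X Y W).inv ≫ f ▷ W

/-- A morphism from two factors to none, in front of `W`. -/
def op20 {X Y : C} (f : X ⊗ Y ⟶ 𝟙_ C) (W : C) : X ⊗ Y ⊗ W ⟶ W :=
  (α_ X Y W).inv ≫ f ▷ W ≫ (λ_ W).hom

/-- A morphism from one factor to two factors, in front of `W`. -/
def op12 {X Z T : C} (f : X ⟶ Z ⊗ T) (W : C) : X ⊗ W ⟶ Z ⊗ T ⊗ W :=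
  f ▷ W ≫ (α_ Z T W).hom

/-- A morphism from one factor to one factor, in front of `W`. -/
def op11 {X Z : C} (f : X ⟶ Z) (W : C) : X ⊗ W ⟶ Z ⊗ W :=
  f ▷ W

/-- A morphism from one factor to none, in front of `W`. -/
def op10 {X : C} (f : X ⟶ 𝟙_ C) (W : C) : X ⊗ W ⟶ W :=
  f ▷ W ≫ (λ_ W).hom

/-- A morphism from no factor to two factors, in front of `W`. -/
def op02 {Z T : C} (f : 𝟙_ C ⟶ Z ⊗ T) (W : C) : W ⟶ Z ⊗ T ⊗ W :=
  (λ_ W).inv ≫ f ▷ W ≫ (α_ Z T W).hom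

/-- A morphism from no factor to one factor, in front of `W`. -/
def op01 {Z : C} (f : 𝟙_ C ⟶ Z) (W : C) : W ⟶ Z ⊗ W :=
  (λ_ W).inv ≫ f ▷ W

variable {A A₂ X Y Z T W W₂ V : C} (g : W ⟶ W₂)

@[simp] lemma op22_exchange (f : X ⊗ Y ⟶ Z ⊗ T) :
    X ◁ Y ◁ g ≫ op22 f W₂ = op22 f W ≫ Z ◁ T ◁ g := by
  simp only [op22, Category.assoc, associator_inv_naturality_right_assoc, whisker_exchange_assoc,
    associator_naturality_right]

@[simp] lemma op22_exchange_assoc (f : X ⊗ Y ⟶ Z ⊗ T) (k : Z ⊗ T ⊗ W₂ ⟶ V) :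
    X ◁ Y ◁ g ≫ op22 f W₂ ≫ k = op22 f W ≫ Z ◁ T ◁ g ≫ k := by
  rw [← Category.assoc, op22_exchange, Category.assoc]

@[simp] lemma op21_exchange (f : X ⊗ Y ⟶ Z) :
    X ◁ Y ◁ g ≫ op21 f W₂ = op21 f W ≫ Z ◁ g := by
  simp only [op21, Category.assoc, associator_inv_naturality_right_assoc, whisker_exchange]

@[simp] lemma op21_exchange_assoc (f : X ⊗ Y ⟶ Z) (k : Z ⊗ W₂ ⟶ V) :
    X ◁ Y ◁ g ≫ op21 f W₂ ≫ k = op21 f W ≫ Z ◁ g ≫ k := by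
  rw [← Category.assoc, op21_exchange, Category.assoc]

@[simp] lemma op20_exchange (f : X ⊗ Y ⟶ 𝟙_ C) :
    X ◁ Y ◁ g ≫ op20 f W₂ = op20 f W ≫ g := by
  simp only [op20, Category.assoc, associator_inv_naturality_right_assoc, whisker_exchange_assoc,
    leftUnitor_naturality]

@[simp] lemma op20_exchange_assoc (f : X ⊗ Y ⟶ 𝟙_ C) (k : W₂ ⟶ V) :
    X ◁ Y ◁ g ≫ op20 f W₂ ≫ k = op20 f W ≫ g ≫ k := by
  rw [← Category.assoc, op20_exchange, Category.assoc]

@[simp] lemma op12_exchange (f : X ⟶ Z ⊗ T) :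
    X ◁ g ≫ op12 f W₂ = op12 f W ≫ Z ◁ T ◁ g := by
  simp only [op12, Category.assoc, whisker_exchange_assoc, associator_naturality_right]

@[simp] lemma op12_exchange_assoc (f : X ⟶ Z ⊗ T) (k : Z ⊗ T ⊗ W₂ ⟶ V) :
    X ◁ g ≫ op12 f W₂ ≫ k = op12 f W ≫ Z ◁ T ◁ g ≫ k := by
  rw [← Category.assoc, op12_exchange, Category.assoc]

@[simp] lemma op11_exchange (f : X ⟶ Z) :
    X ◁ g ≫ op11 f W₂ = op11 f W ≫ Z ◁ g := by
  simp only [op11, whisker_exchange]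

@[simp] lemma op11_exchange_assoc (f : X ⟶ Z) (k : Z ⊗ W₂ ⟶ V) :
    X ◁ g ≫ op11 f W₂ ≫ k = op11 f W ≫ Z ◁ g ≫ k := by
  rw [← Category.assoc, op11_exchange, Category.assoc]

@[simp] lemma op10_exchange (f : X ⟶ 𝟙_ C) :
    X ◁ g ≫ op10 f W₂ = op10 f W ≫ g := by
  simp only [op10, Category.assoc, whisker_exchange_assoc, leftUnitor_naturality]

@[simp] lemma op02_exchange (f : 𝟙_ C ⟶ Z ⊗ T) :
    g ≫ op02 f W₂ = op02 f W ≫ Z ◁ T ◁ g := by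
  simp only [op02, Category.assoc, leftUnitor_inv_naturality_assoc, whisker_exchange_assoc,
    associator_naturality_right]

@[simp] lemma op02_exchange_assoc (f : 𝟙_ C ⟶ Z ⊗ T) (k : Z ⊗ T ⊗ W₂ ⟶ V) :
    g ≫ op02 f W₂ ≫ k = op02 f W ≫ Z ◁ T ◁ g ≫ k := by
  rw [← Category.assoc, op02_exchange, Category.assoc]

-- The subscript counts untouched factors on the left. Each depth needs its own rule because simp
-- distributes left whiskering over composites.
@[simp] lemma op22_exchange₁ (f : X ⊗ Y ⟶ Z ⊗ T) :
    A ◁ X ◁ Y ◁ g ≫ A ◁ op22 f W₂ = A ◁ op22 f W ≫ A ◁ Z ◁ T ◁ g := by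
  simp only [← whiskerLeft_comp, op22_exchange]

@[simp] lemma op22_exchange₁_assoc (f : X ⊗ Y ⟶ Z ⊗ T) (k : A ⊗ Z ⊗ T ⊗ W₂ ⟶ V) :
    A ◁ X ◁ Y ◁ g ≫ A ◁ op22 f W₂ ≫ k = A ◁ op22 f W ≫ A ◁ Z ◁ T ◁ g ≫ k := by
  rw [← Category.assoc, op22_exchange₁, Category.assoc]

@[simp] lemma op21_exchange₁ (f : X ⊗ Y ⟶ Z) :
    A ◁ X ◁ Y ◁ g ≫ A ◁ op21 f W₂ = A ◁ op21 f W ≫ A ◁ Z ◁ g := by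
  simp only [← whiskerLeft_comp, op21_exchange]

@[simp] lemma op20_exchange₁ (f : X ⊗ Y ⟶ 𝟙_ C) :
    A ◁ X ◁ Y ◁ g ≫ A ◁ op20 f W₂ = A ◁ op20 f W ≫ A ◁ g := by
  simp only [← whiskerLeft_comp, op20_exchange]

@[simp] lemma op20_exchange₁_assoc (f : X ⊗ Y ⟶ 𝟙_ C) (k : A ⊗ W₂ ⟶ V) :
    A ◁ X ◁ Y ◁ g ≫ A ◁ op20 f W₂ ≫ k = A ◁ op20 f W ≫ A ◁ g ≫ k := by
  rw [← Category.assoc, op20_exchange₁, Category.assoc]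

@[simp] lemma op12_exchange₁ (f : X ⟶ Z ⊗ T) :
    A ◁ X ◁ g ≫ A ◁ op12 f W₂ = A ◁ op12 f W ≫ A ◁ Z ◁ T ◁ g := by
  simp only [← whiskerLeft_comp, op12_exchange]

@[simp] lemma op12_exchange₁_assoc (f : X ⟶ Z ⊗ T) (k : A ⊗ Z ⊗ T ⊗ W₂ ⟶ V) :
    A ◁ X ◁ g ≫ A ◁ op12 f W₂ ≫ k = A ◁ op12 f W ≫ A ◁ Z ◁ T ◁ g ≫ k := by
  rw [← Category.assoc, op12_exchange₁, Category.assoc]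

@[simp] lemma op11_exchange₁ (f : X ⟶ Z) :
    A ◁ X ◁ g ≫ A ◁ op11 f W₂ = A ◁ op11 f W ≫ A ◁ Z ◁ g := by
  simp only [← whiskerLeft_comp, op11_exchange]

@[simp] lemma op11_exchange₁_assoc (f : X ⟶ Z) (k : A ⊗ Z ⊗ W₂ ⟶ V) :
    A ◁ X ◁ g ≫ A ◁ op11 f W₂ ≫ k = A ◁ op11 f W ≫ A ◁ Z ◁ g ≫ k := by
  rw [← Category.assoc, op11_exchange₁, Category.assoc]

@[simp] lemma op22_exchange₂ (f : X ⊗ Y ⟶ Z ⊗ T) :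
    A ◁ A₂ ◁ X ◁ Y ◁ g ≫ A ◁ A₂ ◁ op22 f W₂ = A ◁ A₂ ◁ op22 f W ≫ A ◁ A₂ ◁ Z ◁ T ◁ g := by
  simp only [← whiskerLeft_comp, op22_exchange]

@[simp] lemma op22_exchange₂_assoc (f : X ⊗ Y ⟶ Z ⊗ T) (k : A ⊗ A₂ ⊗ Z ⊗ T ⊗ W₂ ⟶ V) :
    A ◁ A₂ ◁ X ◁ Y ◁ g ≫ A ◁ A₂ ◁ op22 f W₂ ≫ k = A ◁ A₂ ◁ op22 f W ≫ A ◁ A₂ ◁ Z ◁ T ◁ g ≫ k := by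
  rw [← Category.assoc, op22_exchange₂, Category.assoc]

@[simp] lemma op20_exchange₂ (f : X ⊗ Y ⟶ 𝟙_ C) :
    A ◁ A₂ ◁ X ◁ Y ◁ g ≫ A ◁ A₂ ◁ op20 f W₂ = A ◁ A₂ ◁ op20 f W ≫ A ◁ A₂ ◁ g := by
  simp only [← whiskerLeft_comp, op20_exchange]

@[simp] lemma op20_exchange₂_assoc (f : X ⊗ Y ⟶ 𝟙_ C) (k : A ⊗ A₂ ⊗ W₂ ⟶ V) :
    A ◁ A₂ ◁ X ◁ Y ◁ g ≫ A ◁ A₂ ◁ op20 f W₂ ≫ k = A ◁ A₂ ◁ op20 f W ≫ A ◁ A₂ ◁ g ≫ k := by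
  rw [← Category.assoc, op20_exchange₂, Category.assoc]

@[simp] lemma op12_exchange₂ (f : X ⟶ Z ⊗ T) :
    A ◁ A₂ ◁ X ◁ g ≫ A ◁ A₂ ◁ op12 f W₂ = A ◁ A₂ ◁ op12 f W ≫ A ◁ A₂ ◁ Z ◁ T ◁ g := by
  simp only [← whiskerLeft_comp, op12_exchange]

@[simp] lemma op12_exchange₂_assoc (f : X ⟶ Z ⊗ T) (k : A ⊗ A₂ ⊗ Z ⊗ T ⊗ W₂ ⟶ V) :
    A ◁ A₂ ◁ X ◁ g ≫ A ◁ A₂ ◁ op12 f W₂ ≫ k = A ◁ A₂ ◁ op12 f W ≫ A ◁ A₂ ◁ Z ◁ T ◁ g ≫ k := by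
  rw [← Category.assoc, op12_exchange₂, Category.assoc]

end Operations

/-! ### Removing the tail, and unit laws -/

section Tails

variable {C : Type u} [Category.{v} C] [MonoidalCategory C]

/-- Tensoring with the unit object loses nothing, so an equation proved in tailed form returns to
its original form. -/
lemma op21_injective {X Y Z : C} {f g : X ⊗ Y ⟶ Z} (h : op21 f (𝟙_ C) = op21 g (𝟙_ C)) :
    f = g := by
  simpa [op21] using h

lemma op22_injective {X Y Z T : C} {f g : X ⊗ Y ⟶ Z ⊗ T}
    (h : op22 f (𝟙_ C) = op22 g (𝟙_ C)) : f = g := by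
  simpa [op22] using h

lemma op12_injective {X Z T : C} {f g : X ⟶ Z ⊗ T}
    (h : op12 f (𝟙_ C) = op12 g (𝟙_ C)) : f = g := by
  simpa [op12] using h

lemma op11_injective {X Z : C} {f g : X ⟶ Z} (h : op11 f (𝟙_ C) = op11 g (𝟙_ C)) : f = g := by
  simpa [op11] using h

lemma op_one_mul (W : C) {A : C} [UnitalMagmaObj A] :
    op01 (η A) _ ≫ op21 (μ A) W = 𝟙 _ := by
  have h : η A ▷ A ≫ μ A = (λ_ A).hom := UnitalMagmaObj.one_mul
  simp [op01, op21, ← comp_whiskerRight, h]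

lemma op_mul_one (W : C) {A : C} [UnitalMagmaObj A] :
    A ◁ op01 (η A) W ≫ op21 (μ A) W = 𝟙 _ := by
  have h : A ◁ η A ≫ μ A = (ρ_ A).hom := UnitalMagmaObj.mul_one
  simp only [op01, op21, whiskerLeft_comp, Category.assoc, associator_inv_naturality_middle_assoc,
    ← comp_whiskerRight, h]
  simp

lemma op11_comp {X Y Z : C} (f : X ⟶ Y) (g : Y ⟶ Z) (W : C) :
    op11 (f ≫ g) W = op11 f W ≫ op11 g W := by
  simp [op11]

end Tails

/-! ### The weak bialgebra axioms in tailed form -/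

section Quasigroup

variable {C : Type u} [Category.{v} C] [MonoidalCategory C] [BraidedCategory C]
variable (H : C) [WeakHopfQuasigroup H] (W : C)

/-- The pairing `ε ∘ μ`. -/
def pairing : H ⊗ H ⟶ 𝟙_ C := μ H ≫ ε H

/-- The copairing `δ ∘ η`. -/
def copairing : 𝟙_ C ⟶ H ⊗ H := η H ≫ δ H

lemma op_mul_counit : op21 (μ H) W ≫ op10 (ε H) W = op20 (pairing H) W := by
  simp [op21, op10, op20, pairing]

lemma op_one_comul : op01 (η H) W ≫ op12 (δ H) W = op02 (copairing H) W := by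
  simp [op01, op12, op02, copairing]

lemma op_counit_comul : op12 (δ H) W ≫ op10 (ε H) _ = 𝟙 _ := by
  have h : δ H ≫ ε H ▷ H = (λ_ H).inv := ComonObj.counit_comul H
  simp only [op12, op10, Category.assoc, ← associator_naturality_left_assoc,
    ← comp_whiskerRight_assoc, h]
  simp

lemma op_comul_counit : op12 (δ H) W ≫ H ◁ op10 (ε H) _ = 𝟙 _ := by
  have h : δ H ≫ H ◁ ε H = (ρ_ H).inv := ComonObj.comul_counit H
  simp only [op12, op10, Category.assoc, whiskerLeft_comp, ← associator_naturality_middle_assoc,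
    ← comp_whiskerRight_assoc, h]
  simp

lemma op_comul_assoc :
    op12 (δ H) W ≫ H ◁ op12 (δ H) _ = op12 (δ H) W ≫ op12 (δ H) _ := by
  have h : δ H ≫ H ◁ δ H = δ H ≫ δ H ▷ H ≫ (α_ H H H).hom := ComonObj.comul_assoc H
  simp only [op12, Category.assoc, whiskerLeft_comp, ← associator_naturality_middle_assoc,
    ← comp_whiskerRight_assoc, h]
  simp

lemma op_mul_comul :
    op21 (μ H) W ≫ op12 (δ H) W =
      op12 (δ H) _ ≫ H ◁ H ◁ op12 (δ H) W ≫ H ◁ op22 (β_ H H).hom _ ≫ op21 (μ H) _ ≫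
        H ◁ op21 (μ H) W := by
  have h : μ H ≫ δ H = _ := WeakHopfQuasigroup.mul_comul
  calc _ = (α_ H H W).inv ≫ (μ H ≫ δ H) ▷ W ≫ (α_ H H W).hom := by simp [op21, op12]
    _ = _ := by
      rw [h, tensorμ, MonoidalCategory.tensorHom_def, MonoidalCategory.tensorHom_def]
      simp only [op21, op12, op22]
      monoidal

lemma op_pairing_assoc :
    H ◁ op21 (μ H) W ≫ op20 (pairing H) W = op21 (μ H) _ ≫ op20 (pairing H) W := by
  have h : μ H ▷ H ≫ μ H ≫ ε H = _ := WeakHopfQuasigroup.counit_mul_assoc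
  have h' : H ◁ μ H ≫ μ H ≫ ε H = (α_ H H H).inv ≫ μ H ▷ H ≫ μ H ≫ ε H := by rw [h]; simp
  calc _ = 𝟙 _ ⊗≫ (H ◁ μ H ≫ μ H ≫ ε H) ▷ W ⊗≫ 𝟙 _ := by
        simp only [op21, op20, pairing]; monoidal
    _ = _ := by rw [h']; simp only [op21, op20, pairing]; monoidal

lemma op_pairing_mul :
    op21 (μ H) _ ≫ op20 (pairing H) W =
      H ◁ op12 (δ H) _ ≫ op20 (pairing H) _ ≫ op20 (pairing H) W := by
  have h : μ H ▷ H ≫ μ H ≫ ε H = _ := WeakHopfQuasigroup.counit_mul_mul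
  calc _ = (α_ H H _).inv ≫ (α_ _ H W).inv ≫ (μ H ▷ H ≫ μ H ≫ ε H) ▷ W ≫ (λ_ W).hom := by
        simp only [op21, op20, pairing]; monoidal
    _ = _ := by
      rw [h, MonoidalCategory.tensorHom_def]; simp only [op12, op20, pairing]; monoidal

lemma op_pairing_mul' :
    op21 (μ H) _ ≫ op20 (pairing H) W =
      H ◁ op12 (δ H) _ ≫ H ◁ op22 (β_ H H).inv _ ≫ op20 (pairing H) _ ≫ op20 (pairing H) W := by
  have h : μ H ▷ H ≫ μ H ≫ ε H = _ := WeakHopfQuasigroup.counit_mul_mul'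
  calc _ = (α_ H H _).inv ≫ (α_ _ H W).inv ≫ (μ H ▷ H ≫ μ H ≫ ε H) ▷ W ≫ (λ_ W).hom := by
        simp only [op21, op20, pairing]; monoidal
    _ = _ := by
      rw [h, MonoidalCategory.tensorHom_def]; simp only [op12, op22, op20, pairing]; monoidal

lemma op_copairing_comul :
    op02 (copairing H) W ≫ H ◁ op12 (δ H) _ =
      op02 (copairing H) W ≫ H ◁ H ◁ op02 (copairing H) W ≫ H ◁ op21 (μ H) _ := by
  have h : η H ≫ δ H ≫ δ H ▷ H = _ := WeakHopfQuasigroup.one_comul_comul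
  have h' : η H ≫ δ H ≫ δ H ▷ H = η H ≫ δ H ≫ H ◁ δ H ≫ (α_ H H H).inv := by
    have := ComonObj.comul_assoc H
    rw [reassoc_of% this]; simp
  calc _ = (λ_ W).inv ≫ (η H ≫ δ H ≫ H ◁ δ H ≫ (α_ H H H).inv) ▷ W ⊗≫ 𝟙 _ := by
        simp only [op02, op12, copairing]; monoidal
    _ = _ := by
      rw [← h', h, MonoidalCategory.tensorHom_def]; simp only [op02, op21, copairing]; monoidal

end Quasigroup

/-! ### Naturality and hexagon laws for moving operations through crossings -/

section Braiding

variable {C : Type u} [Category.{v} C] [MonoidalCategory C] [BraidedCategory C]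

lemma op11_braiding {X X' : C} (f : X ⟶ X') (Y W : C) :
    op11 f (Y ⊗ W) ≫ op22 (β_ X' Y).hom W = op22 (β_ X Y).hom W ≫ Y ◁ op11 f W := by
  calc _ = (α_ X Y W).inv ≫ (f ▷ Y ≫ (β_ X' Y).hom) ▷ W ≫ (α_ _ _ W).hom := by
        simp only [op11, op22]; monoidal
    _ = _ := by
      rw [BraidedCategory.braiding_naturality_left]; simp only [op11, op22]; monoidal

lemma whiskerLeft_op11_braiding (X : C) {Y Y' : C} (f : Y ⟶ Y') (W : C) :
    X ◁ op11 f W ≫ op22 (β_ X Y').hom W = op22 (β_ X Y).hom W ≫ op11 f (X ⊗ W) := by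
  calc _ = (α_ X Y W).inv ≫ (X ◁ f ≫ (β_ X Y').hom) ▷ W ≫ (α_ _ _ W).hom := by
        simp only [op11, op22]; monoidal
    _ = _ := by
      rw [BraidedCategory.braiding_naturality_right]; simp only [op11, op22]; monoidal

lemma whiskerLeft_op21_braiding (X : C) {Y Z Y' : C} (f : Y ⊗ Z ⟶ Y') (W : C) :
    X ◁ op21 f W ≫ op22 (β_ X Y').hom W =
      op22 (β_ X Y).hom (Z ⊗ W) ≫ Y ◁ op22 (β_ X Z).hom W ≫ op21 f (X ⊗ W) := by
  calc _ = 𝟙 _ ⊗≫ (X ◁ f ≫ (β_ X Y').hom) ▷ W ⊗≫ 𝟙 _ := by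
        simp only [op21, op22]; monoidal
    _ = _ := by
      rw [BraidedCategory.braiding_naturality_right, BraidedCategory.braiding_tensor_right_hom]
      simp only [op21, op22]; monoidal

lemma op12_braiding {X X₁ X₂ : C} (f : X ⟶ X₁ ⊗ X₂) (Y W : C) :
    op12 f (Y ⊗ W) ≫ X₁ ◁ op22 (β_ X₂ Y).hom W ≫ op22 (β_ X₁ Y).hom (X₂ ⊗ W) =
      op22 (β_ X Y).hom W ≫ Y ◁ op12 f W := by
  calc _ = 𝟙 _ ⊗≫ (f ▷ Y ≫ (β_ (X₁ ⊗ X₂) Y).hom) ▷ W ⊗≫ 𝟙 _ := by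
        rw [BraidedCategory.braiding_tensor_left_hom]
        simp only [op12, op22]; monoidal
    _ = _ := by
      rw [BraidedCategory.braiding_naturality_left]
      simp only [op12, op22]; monoidal

lemma whiskerLeft_op12_braiding (X : C) {Y Y₁ Y₂ : C} (f : Y ⟶ Y₁ ⊗ Y₂) (W : C) :
    X ◁ op12 f W ≫ op22 (β_ X Y₁).hom (Y₂ ⊗ W) ≫ Y₁ ◁ op22 (β_ X Y₂).hom W =
      op22 (β_ X Y).hom W ≫ op12 f (X ⊗ W) := by
  calc _ = 𝟙 _ ⊗≫ (X ◁ f ≫ (β_ X (Y₁ ⊗ Y₂)).hom) ▷ W ⊗≫ 𝟙 _ := by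
        rw [BraidedCategory.braiding_tensor_right_hom]
        simp only [op12, op22]; monoidal
    _ = _ := by
      rw [BraidedCategory.braiding_naturality_right]
      simp only [op12, op22]; monoidal

lemma op22_braiding {X Y X' Y' : C} (f : X ⊗ Y ⟶ X' ⊗ Y') (Z W : C) :
    X ◁ op22 (β_ Y Z).hom W ≫ op22 (β_ X Z).hom (Y ⊗ W) ≫ Z ◁ op22 f W =
      op22 f (Z ⊗ W) ≫ X' ◁ op22 (β_ Y' Z).hom W ≫ op22 (β_ X' Z).hom (Y' ⊗ W) := by
  calc _ = 𝟙 _ ⊗≫ ((β_ (X ⊗ Y) Z).hom ≫ Z ◁ f) ▷ W ⊗≫ 𝟙 _ := by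
        rw [BraidedCategory.braiding_tensor_left_hom]
        simp only [op22]; monoidal
    _ = _ := by
      rw [← BraidedCategory.braiding_naturality_left, BraidedCategory.braiding_tensor_left_hom]
      simp only [op22]; monoidal

lemma op20_braiding {X Y : C} (e : X ⊗ Y ⟶ 𝟙_ C) (Z W : C) :
    X ◁ op22 (β_ Y Z).hom W ≫ op22 (β_ X Z).hom (Y ⊗ W) ≫ Z ◁ op20 e W = op20 e (Z ⊗ W) := by
  calc _ = 𝟙 _ ⊗≫ ((β_ (X ⊗ Y) Z).hom ≫ Z ◁ e) ▷ W ⊗≫ 𝟙 _ := by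
        rw [BraidedCategory.braiding_tensor_left_hom]
        simp only [op22, op20]; monoidal
    _ = _ := by
      rw [← BraidedCategory.braiding_naturality_left, braiding_tensorUnit_left]
      simp only [op20]; monoidal

lemma op02_braiding {X Y : C} (d : 𝟙_ C ⟶ X ⊗ Y) (Z W : C) :
    op02 d (Z ⊗ W) ≫ X ◁ op22 (β_ Y Z).hom W ≫ op22 (β_ X Z).hom (Y ⊗ W) = Z ◁ op02 d W := by
  calc _ = 𝟙 _ ⊗≫ (d ▷ Z ≫ (β_ (X ⊗ Y) Z).hom) ▷ W ⊗≫ 𝟙 _ := by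
        rw [BraidedCategory.braiding_tensor_left_hom]
        simp only [op22, op02]; monoidal
    _ = _ := by
      rw [BraidedCategory.braiding_naturality_left, braiding_tensorUnit_left]
      simp only [op02]; monoidal

lemma op22_braiding_hom_inv (X Y W : C) :
    op22 (β_ X Y).hom W ≫ op22 (β_ X Y).inv W = 𝟙 _ := by
  simp [op22]

lemma op22_braiding_inv_hom (X Y W : C) :
    op22 (β_ X Y).inv W ≫ op22 (β_ X Y).hom W = 𝟙 _ := by
  simp [op22]

/-- A strand can be pulled past a whole pairing, so an inverse crossing with one leg trades for a
crossing with the other. This is what removes inverse braidings from the computations. -/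
lemma op20_slide {X Y : C} (e : X ⊗ Y ⟶ 𝟙_ C) (Z W : C) :
    X ◁ op22 (β_ Y Z).inv W ≫ op20 e (Z ⊗ W) = op22 (β_ X Z).hom (Y ⊗ W) ≫ Z ◁ op20 e W := by
  rw [← op20_braiding, ← Category.assoc, ← whiskerLeft_comp, op22_braiding_inv_hom]
  simp

lemma op02_slide {X Y : C} (d : 𝟙_ C ⟶ X ⊗ Y) (Z W : C) :
    Z ◁ op02 d W ≫ op22 (β_ X Z).inv (Y ⊗ W) = op02 d (Z ⊗ W) ≫ X ◁ op22 (β_ Y Z).hom W := by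
  rw [← op02_braiding]
  simp [op22_braiding_hom_inv]

end Braiding

/-! ### Source and target morphisms, and the legs of coinvariants -/

section Quasigroup

variable {C : Type u} [Category.{v} C] [MonoidalCategory C] [BraidedCategory C]
variable (H : C) [WeakHopfQuasigroup H] (W : C)

lemma op_PiRBar : op11 (PiRBar H) W = H ◁ op02 (copairing H) W ≫ op20 (pairing H) _ := by
  simp only [op11, op02, op20, copairing, pairing, PiRBar]; monoidal

lemma op_PiR :
    op11 (PiR H) W =
      H ◁ op02 (copairing H) W ≫ op22 (β_ H H).hom _ ≫ H ◁ op20 (pairing H) _ := by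
  have h : PiR H = _ := WeakHopfQuasigroup.source_eq
  rw [h]
  simp only [op11, op02, op20, op22, copairing, pairing]; monoidal

lemma op_PiL :
    op11 (PiL H) W =
      H ◁ op02 (copairing H) W ≫ op22 (β_ H H).inv _ ≫ op20 (pairing H) _ := by
  have h : PiL H = _ := WeakHopfQuasigroup.target_eq
  rw [h, reassoc_of% op02_slide (copairing H) H W]
  simp only [op11, op02, op20, op22, copairing, pairing]; monoidal

lemma op_PiL_conv :
    op11 (PiL H) W = op12 (δ H) W ≫ H ◁ op11 (anti H) W ≫ op21 (μ H) W := by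
  rw [PiL, conv, MonoidalCategory.tensorHom_def]
  simp only [op11, op12, op21]; monoidal

lemma op_antipode_mul :
    op11 (PiR H) _ ≫ op21 (μ H) W =
      op12 (δ H) _ ≫ op11 (anti H) _ ≫ H ◁ op21 (μ H) W ≫ op21 (μ H) W := by
  have h : _ = PiR H ▷ H ≫ μ H := WeakHopfQuasigroup.antipode_mul_left
  calc _ = (α_ _ _ _).inv ≫ (PiR H ▷ H ≫ μ H) ▷ W := by simp only [op11, op21]; monoidal
    _ = _ := by
      rw [← h, MonoidalCategory.tensorHom_def]; simp only [op11, op12, op21]; monoidal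

/-- This is the counit law for `a b`, with its coproduct expanded: `ε(a₁ b₁) a₂ b₂ = a b`. -/
lemma op_counit_mul_comul :
    op12 (δ H) _ ≫ H ◁ H ◁ op12 (δ H) W ≫ H ◁ op22 (β_ H H).hom _ ≫ op20 (pairing H) _ ≫
      op21 (μ H) W = op21 (μ H) W := by
  calc _ = (op12 (δ H) _ ≫ H ◁ H ◁ op12 (δ H) W ≫ H ◁ op22 (β_ H H).hom _ ≫ op21 (μ H) _ ≫
        H ◁ op21 (μ H) W) ≫ op10 (ε H) _ := by
        simp [← op_mul_counit]
    _ = _ := by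
      rw [← op_mul_comul, Category.assoc, op_counit_comul, Category.comp_id]

lemma op_mul_comul_counit :
    op12 (δ H) _ ≫ H ◁ H ◁ op12 (δ H) W ≫ H ◁ op22 (β_ H H).hom _ ≫ op21 (μ H) _ ≫
      H ◁ op20 (pairing H) W = op21 (μ H) W := by
  calc _ = (op12 (δ H) _ ≫ H ◁ H ◁ op12 (δ H) W ≫ H ◁ op22 (β_ H H).hom _ ≫ op21 (μ H) _ ≫
        H ◁ op21 (μ H) W) ≫ H ◁ op10 (ε H) _ := by
        simp [← op_mul_counit]
    _ = _ := by
      rw [← op_mul_comul, Category.assoc, op_comul_counit, Category.comp_id]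

/-- With `L(z, c) = ε(z c₁) c₂`, one has `L(z, c d) = L(z, c) d`. -/
lemma op_tgtPair_mul :
    H ◁ op21 (μ H) W ≫ H ◁ op12 (δ H) W ≫ op20 (pairing H) _ =
      H ◁ op12 (δ H) _ ≫ op20 (pairing H) _ ≫ op21 (μ H) W := by
  -- In elements: `ε(z(c₁ d₁)) c₂ d₂ = ε((z c₁) d₁) c₂ d₂ = ε(z c₁) ε(c₂ d₁) c₃ d₂ = ε(z c₁) c₂ d`.
  calc
    _ = H ◁ (op21 (μ H) W ≫ op12 (δ H) W) ≫ op20 (pairing H) _ := by simp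
    _ = H ◁ op12 (δ H) _ ≫ H ◁ H ◁ H ◁ op12 (δ H) W ≫ H ◁ H ◁ op22 (β_ H H).hom _ ≫
          (H ◁ op21 (μ H) _ ≫ op20 (pairing H) _) ≫ op21 (μ H) W := by
      rw [op_mul_comul]; simp
    _ = H ◁ (op12 (δ H) _ ≫ op12 (δ H) _) ≫ H ◁ H ◁ H ◁ H ◁ op12 (δ H) W ≫
          H ◁ H ◁ H ◁ op22 (β_ H H).hom _ ≫
          op20 (pairing H) _ ≫ op20 (pairing H) _ ≫ op21 (μ H) W := by
      rw [op_pairing_assoc, op_pairing_mul]; simp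
    _ = H ◁ op12 (δ H) _ ≫ op20 (pairing H) _ ≫
          op12 (δ H) _ ≫ H ◁ H ◁ op12 (δ H) W ≫ H ◁ op22 (β_ H H).hom _ ≫
          op20 (pairing H) _ ≫ op21 (μ H) W := by
      rw [← op_comul_assoc]; simp
    _ = _ := by rw [op_counit_mul_comul]

/-- `Π̄^R(z) c = ε(z c₁) c₂`. -/
lemma op_PiRBar_mul :
    op11 (PiRBar H) _ ≫ op21 (μ H) W = H ◁ op12 (δ H) W ≫ op20 (pairing H) _ := by
  calc _ = H ◁ op01 (η H) _ ≫ H ◁ op12 (δ H) _ ≫ op20 (pairing H) _ ≫ op21 (μ H) W := by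
        rw [op_PiRBar, ← op_one_comul]; simp
    _ = H ◁ (op01 (η H) _ ≫ op21 (μ H) W) ≫ H ◁ op12 (δ H) W ≫ op20 (pairing H) _ := by
      rw [← op_tgtPair_mul]; simp
    _ = _ := by rw [op_one_mul]; simp

/-- With `R(z, a) = a₁ ε(z a₂)`, one has `R(z, a b) = R(z, a) b`. -/
lemma op_srcPair_mul :
    H ◁ op21 (μ H) W ≫ H ◁ op12 (δ H) W ≫ op22 (β_ H H).hom _ ≫ H ◁ op20 (pairing H) W =
      H ◁ op12 (δ H) _ ≫ op22 (β_ H H).hom _ ≫ H ◁ op20 (pairing H) _ ≫ op21 (μ H) W := by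
  -- In elements: `a₁ b₁ ε((z a₂) b₂) = a₁ b₁ ε(z a₃) ε(a₂ b₂) = a₁ ε(z a₂) b`. The inverse-braided
  -- counit axiom is needed so that `a₂`, adjacent to `a₁`, is the leg paired with `b₂`. The
  -- remaining steps untangle the crossings.
  calc
    _ = H ◁ (op21 (μ H) W ≫ op12 (δ H) W) ≫ op22 (β_ H H).hom _ ≫ H ◁ op20 (pairing H) W := by
      simp
    _ = H ◁ op12 (δ H) _ ≫ H ◁ H ◁ H ◁ op12 (δ H) W ≫ H ◁ H ◁ op22 (β_ H H).hom _ ≫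
          (H ◁ op21 (μ H) _ ≫ op22 (β_ H H).hom _) ≫ H ◁ H ◁ op21 (μ H) W ≫
          H ◁ op20 (pairing H) W := by
      rw [op_mul_comul]; simp
    _ = H ◁ op12 (δ H) _ ≫ H ◁ H ◁ H ◁ op12 (δ H) W ≫ H ◁ H ◁ op22 (β_ H H).hom _ ≫
          op22 (β_ H H).hom _ ≫ H ◁ op22 (β_ H H).hom _ ≫
          H ◁ H ◁ (H ◁ op21 (μ H) W ≫ op20 (pairing H) W) ≫ op21 (μ H) _ := by
      rw [whiskerLeft_op21_braiding]; simp
    _ = H ◁ op12 (δ H) _ ≫ H ◁ H ◁ H ◁ op12 (δ H) W ≫ op22 (β_ H H).hom _ ≫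
          H ◁ H ◁ (op22 (β_ H H).hom _ ≫ H ◁ op12 (δ H) _) ≫ H ◁ op22 (β_ H H).hom _ ≫
          H ◁ H ◁ H ◁ op22 (β_ H H).inv _ ≫ H ◁ H ◁ op20 (pairing H) _ ≫
          H ◁ H ◁ op20 (pairing H) W ≫ op21 (μ H) _ := by
      rw [op_pairing_assoc, op_pairing_mul']; simp
    _ = H ◁ op12 (δ H) _ ≫ H ◁ H ◁ op12 (δ H) _ ≫ H ◁ H ◁ H ◁ H ◁ op12 (δ H) W ≫
          op22 (β_ H H).hom _ ≫ H ◁ H ◁ (H ◁ op22 (β_ H H).hom _ ≫ op22 (β_ H H).hom _ ≫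
            H ◁ op22 (β_ H H).inv _) ≫
          H ◁ op22 (β_ H H).hom _ ≫ H ◁ H ◁ op20 (pairing H) _ ≫
          H ◁ H ◁ op20 (pairing H) W ≫ op21 (μ H) _ := by
      rw [← op12_braiding]; simp
    _ = H ◁ op12 (δ H) _ ≫ H ◁ H ◁ op12 (δ H) _ ≫ H ◁ H ◁ H ◁ H ◁ op12 (δ H) W ≫
          op22 (β_ H H).hom _ ≫ H ◁ H ◁ (op22 (β_ H H).inv _ ≫ H ◁ op22 (β_ H H).hom _) ≫
          H ◁ (H ◁ op22 (β_ H H).hom _ ≫ op22 (β_ H H).hom _ ≫ H ◁ op20 (pairing H) _) ≫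
          H ◁ H ◁ op20 (pairing H) W ≫ op21 (μ H) _ := by
      rw [op22_braiding]; simp
    _ = H ◁ (op12 (δ H) _ ≫ H ◁ op12 (δ H) _) ≫ H ◁ H ◁ H ◁ H ◁ op12 (δ H) W ≫
          op22 (β_ H H).hom _ ≫ H ◁ (H ◁ op22 (β_ H H).inv _ ≫ op20 (pairing H) _) ≫
          H ◁ op22 (β_ H H).hom _ ≫ op21 (μ H) _ ≫ H ◁ op20 (pairing H) W := by
      rw [op20_braiding]; simp
    _ = H ◁ op12 (δ H) _ ≫
          (H ◁ op12 (δ H) _ ≫ op22 (β_ H H).hom _ ≫ H ◁ op22 (β_ H H).hom _) ≫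
          H ◁ H ◁ op20 (pairing H) _ ≫ H ◁ H ◁ op12 (δ H) W ≫
          H ◁ op22 (β_ H H).hom _ ≫ op21 (μ H) _ ≫ H ◁ op20 (pairing H) W := by
      rw [op_comul_assoc, op20_slide]; simp
    _ = H ◁ op12 (δ H) _ ≫ op22 (β_ H H).hom _ ≫ H ◁ op20 (pairing H) _ ≫
          op12 (δ H) _ ≫ H ◁ H ◁ op12 (δ H) W ≫
          H ◁ op22 (β_ H H).hom _ ≫ op21 (μ H) _ ≫ H ◁ op20 (pairing H) W := by
      rw [whiskerLeft_op12_braiding]; simp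
    _ = _ := by rw [op_mul_comul_counit]

/-- `Π^R(z) b = b₁ ε(z b₂)`. -/
lemma op_PiR_mul :
    op11 (PiR H) _ ≫ op21 (μ H) W =
      H ◁ op12 (δ H) W ≫ op22 (β_ H H).hom _ ≫ H ◁ op20 (pairing H) W := by
  calc _ = H ◁ op01 (η H) _ ≫ H ◁ op12 (δ H) _ ≫ op22 (β_ H H).hom _ ≫ H ◁ op20 (pairing H) _ ≫
        op21 (μ H) W := by
        rw [op_PiR, ← op_one_comul]; simp
    _ = H ◁ (op01 (η H) _ ≫ op21 (μ H) W) ≫ H ◁ op12 (δ H) W ≫ op22 (β_ H H).hom _ ≫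
        H ◁ op20 (pairing H) W := by
      rw [← op_srcPair_mul]; simp
    _ = _ := by rw [op_one_mul]; simp

/-- `b₁ ⊗ y b₂ = λ(y₁) (y₂ b)₁ ⊗ (y₂ b)₂`; this replaces the anticomultiplicativity of the
antipode in the study of coinvariants. -/
lemma op_mulSnd_eq :
    H ◁ op12 (δ H) W ≫ op22 (β_ H H).hom _ ≫ H ◁ op21 (μ H) W =
      op12 (δ H) _ ≫ op11 (anti H) _ ≫ H ◁ op21 (μ H) W ≫ H ◁ op12 (δ H) W ≫ op21 (μ H) _ := by
  symm
  -- In elements: `λ(y₁)(y₂ b₁) ⊗ y₃ b₂ = Π^R(y₁) b₁ ⊗ y₂ b₂ = b₁ ε(y₁ b₂) ⊗ y₂ b₃ = b₁ ⊗ y b₂`.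
  calc
    _ = op12 (δ H) _ ≫ op11 (anti H) _ ≫ H ◁ (op21 (μ H) W ≫ op12 (δ H) W) ≫ op21 (μ H) _ := by
      simp
    _ = op12 (δ H) _ ≫ H ◁ op12 (δ H) _ ≫ op11 (anti H) _ ≫ H ◁ H ◁ H ◁ op12 (δ H) W ≫
          H ◁ H ◁ op22 (β_ H H).hom _ ≫ H ◁ op21 (μ H) _ ≫ op21 (μ H) _ ≫
          H ◁ op21 (μ H) W := by
      rw [op_mul_comul]; simp
    _ = op12 (δ H) _ ≫ H ◁ H ◁ op12 (δ H) W ≫ H ◁ op22 (β_ H H).hom _ ≫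
          (op12 (δ H) _ ≫ op11 (anti H) _ ≫ H ◁ op21 (μ H) _ ≫ op21 (μ H) _) ≫
          H ◁ op21 (μ H) W := by
      rw [reassoc_of% op_comul_assoc H]; simp
    _ = op12 (δ H) _ ≫ H ◁ H ◁ op12 (δ H) W ≫ H ◁ (op22 (β_ H H).hom _ ≫
          op12 (δ H) _) ≫ op22 (β_ H H).hom _ ≫ H ◁ op20 (pairing H) _ ≫
          H ◁ op21 (μ H) W := by
      rw [← op_antipode_mul, op_PiR_mul]; simp
    _ = op12 (δ H) _ ≫ H ◁ H ◁ (op12 (δ H) W ≫ op12 (δ H) _) ≫ H ◁ op22 (β_ H H).hom _ ≫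
          op22 (β_ H H).hom _ ≫ H ◁ H ◁ op22 (β_ H H).hom _ ≫ H ◁ op20 (pairing H) _ ≫
          H ◁ op21 (μ H) W := by
      rw [← whiskerLeft_op12_braiding]; simp
    _ = H ◁ op12 (δ H) W ≫ (op12 (δ H) _ ≫ H ◁ op22 (β_ H H).hom _ ≫
          op22 (β_ H H).hom _) ≫ H ◁ H ◁ H ◁ op12 (δ H) _ ≫ H ◁ H ◁ op22 (β_ H H).hom _ ≫
          H ◁ op20 (pairing H) _ ≫ H ◁ op21 (μ H) W := by
      rw [← op_comul_assoc]; simp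
    _ = H ◁ op12 (δ H) W ≫ op22 (β_ H H).hom _ ≫ H ◁ (op12 (δ H) _ ≫
          H ◁ H ◁ op12 (δ H) _ ≫ H ◁ op22 (β_ H H).hom _ ≫
          op20 (pairing H) _ ≫ op21 (μ H) W) := by
      rw [op12_braiding]; simp
    _ = _ := by rw [op_counit_mul_comul]

/-- The second leg of `δ(1)` lies in the image of `Π̄^R`. -/
lemma op_copairing_PiRBar :
    op02 (copairing H) W ≫ H ◁ op11 (PiRBar H) W = op02 (copairing H) W := by
  -- Apply `ε` to the middle leg of `1₁ ⊗ 1₂ 1'₁ ⊗ 1'₂ = 1₁ ⊗ 1₂ ⊗ 1₃`.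
  calc _ = (op02 (copairing H) W ≫ H ◁ H ◁ op02 (copairing H) W ≫ H ◁ op21 (μ H) _) ≫
        H ◁ op10 (ε H) _ := by
        simp [op_PiRBar, ← op_mul_counit]
    _ = op02 (copairing H) W ≫ H ◁ (op12 (δ H) _ ≫ op10 (ε H) _) := by
      rw [← op_copairing_comul]; simp
    _ = _ := by rw [op_counit_comul]; simp

/-- The second leg of `δ(Π^L(y))` lies in the image of `Π̄^R`. -/
lemma op_PiL_comul_PiRBar :
    op11 (PiL H) W ≫ op12 (δ H) W ≫ H ◁ op11 (PiRBar H) W = op11 (PiL H) W ≫ op12 (δ H) W := by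
  have h : op02 (copairing H) W ≫ H ◁ op12 (δ H) W ≫ H ◁ H ◁ op11 (PiRBar H) W =
      op02 (copairing H) W ≫ H ◁ op12 (δ H) W := by
    rw [reassoc_of% op_copairing_comul H, op_copairing_comul]
    calc _ = op02 (copairing H) W ≫ H ◁ H ◁ (op02 (copairing H) W ≫ H ◁ op11 (PiRBar H) W) ≫
          H ◁ op21 (μ H) _ := by simp
      _ = _ := by rw [op_copairing_PiRBar]
  calc _ = H ◁ (op02 (copairing H) W ≫ H ◁ op12 (δ H) W ≫ H ◁ H ◁ op11 (PiRBar H) W) ≫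
        op22 (β_ H H).inv _ ≫ op20 (pairing H) _ := by
        simp [op_PiL]
    _ = _ := by rw [h]; simp [op_PiL]

/-- The morphism `y ↦ λ(y₂)₁ ⊗ y₁ λ(y₂)₂`, through which the coaction on coinvariants factors. -/
def coinvCoact : H ⊗ W ⟶ H ⊗ H ⊗ W :=
  op12 (δ H) W ≫ H ◁ op11 (anti H) W ≫ H ◁ op12 (δ H) W ≫ op22 (β_ H H).hom _ ≫ H ◁ op21 (μ H) W

/-- By `op_mulSnd_eq` and coassociativity the map is also `y ↦ λ(y₁) Π^L(y₂)₁ ⊗ Π^L(y₂)₂`, and the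
second leg of `δ(Π^L)` is fixed by `Π̄^R`. -/
lemma coinvCoact_PiRBar : coinvCoact H W ≫ H ◁ op11 (PiRBar H) W = coinvCoact H W := by
  have h : coinvCoact H W =
      op12 (δ H) W ≫ op11 (anti H) _ ≫ H ◁ (op11 (PiL H) W ≫ op12 (δ H) W) ≫ op21 (μ H) _ := by
    rw [coinvCoact, op_mulSnd_eq, op_PiL_conv]
    calc _ = (op12 (δ H) W ≫ op12 (δ H) _) ≫ op11 (anti H) _ ≫ H ◁ H ◁ op11 (anti H) _ ≫
          H ◁ op21 (μ H) _ ≫ H ◁ op12 (δ H) _ ≫ op21 (μ H) _ := by simp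
      _ = _ := by rw [← op_comul_assoc]; simp
  calc _ = op12 (δ H) W ≫ op11 (anti H) _ ≫ H ◁ (op11 (PiL H) W ≫ op12 (δ H) W ≫
        H ◁ op11 (PiRBar H) W) ≫ op21 (μ H) _ := by rw [h]; simp
    _ = _ := by rw [op_PiL_comul_PiRBar, ← h]

end Quasigroup

/-! ### Hopf modules: the projection onto coinvariants -/

section Modules

variable {C : Type u} [Category.{v} C] [MonoidalCategory C] [BraidedCategory C]
variable {H : C} [WeakHopfQuasigroup H] {B : C} [ComoduleMagma H B] {h : H ⟶ B}

/-- The axioms of a strong Hopf module except for the partial associativity of the action. They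
hold for `B` itself without further assumptions. -/
structure IsHopfModule (h : H ⟶ B) {M : C} (φ : M ⊗ B ⟶ M) (ρ : M ⟶ M ⊗ H) : Prop where
  isComodule : IsRightComodule H ρ
  act_one : M ◁ η B ≫ φ = (ρ_ M).hom
  act_coact : φ ≫ ρ = (ρ ⊗ₘ coactB H B) ≫ tensorμ M H B H ≫ (φ ⊗ₘ μ H)
  cancel_left :
    M ◁ δ H ≫ (α_ M H H).inv ≫ ((M ◁ h ≫ φ) ⊗ₘ (anti H ≫ h)) ≫ φ = M ◁ (PiL H ≫ h) ≫ φ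
  cancel_right :
    M ◁ δ H ≫ (α_ M H H).inv ≫ ((M ◁ (anti H ≫ h) ≫ φ) ⊗ₘ h) ≫ φ = M ◁ (PiR H ≫ h) ≫ φ

lemma IsAnchor.isHopfModule (hh : IsAnchor h) : IsHopfModule h (μ B) (coactB H B) where
  isComodule := ComoduleMagma.isComodule
  act_one := UnitalMagmaObj.mul_one
  act_coact := ComoduleMagma.mul_coact
  cancel_left := hh.cancel_left
  cancel_right := hh.cancel_right

lemma IsStrongHopfModule.isHopfModule {Z : C} {i : Z ⟶ B} {M : C} {φ : M ⊗ B ⟶ M}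
    {ρ : M ⟶ M ⊗ H} (hM : IsStrongHopfModule h i φ ρ) : IsHopfModule h φ ρ where
  isComodule := hM.isComodule
  act_one := hM.act_one
  act_coact := hM.act_coact
  cancel_left := hM.cancel_left
  cancel_right := hM.cancel_right

lemma whiskerLeft_op01_braiding {X : C} (f : 𝟙_ C ⟶ X) (Y W : C) :
    Y ◁ op01 f W ≫ op22 (β_ Y X).hom W = op01 f (Y ⊗ W) := by
  calc _ = 𝟙 _ ⊗≫ (Y ◁ f ≫ (β_ Y X).hom) ▷ W ⊗≫ 𝟙 _ := by
        simp only [op01, op22]; monoidal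
    _ = _ := by
      rw [BraidedCategory.braiding_naturality_right, braiding_tensorUnit_right]
      simp only [op01]; monoidal

/-- Indeed `ε(1₁ 1) 1₂ = ε(1₁) 1₂ = 1`. -/
lemma op_one_PiL (W : C) : op01 (η H) W ≫ op11 (PiL H) W = op01 (η H) W := by
  calc _ = op02 (copairing H) W ≫ H ◁ (H ◁ op01 (η H) W ≫ op22 (β_ H H).hom W) ≫
        op20 (pairing H) _ := by
        rw [op_PiL, reassoc_of% op02_slide (copairing H) H W]; simp
    _ = op02 (copairing H) W ≫ (H ◁ op01 (η H) _ ≫ op21 (μ H) _) ≫ op10 (ε H) _ := by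
        rw [whiskerLeft_op01_braiding]; simp [op_mul_counit]
    _ = _ := by
        rw [op_mul_one, Category.id_comp, ← op_one_comul, Category.assoc, op_counit_comul,
          Category.comp_id]

lemma IsAnchor.op_coact (hh : IsAnchor h) (W : C) :
    op11 h W ≫ op12 (coactB H B) W = op12 (δ H) W ≫ op11 h _ := by
  calc _ = (h ≫ coactB H B) ▷ W ≫ (α_ _ _ _).hom := by simp [op11, op12]
    _ = _ := by rw [hh.colinear]; simp only [op11, op12]; monoidal

lemma IsAnchor.op_one (hh : IsAnchor h) (W : C) : op01 (η H) W ≫ op11 h W = op01 (η B) W := by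
  rw [← hh.map_one]; simp [op11, op01]

lemma IsAnchor.op_copairing (hh : IsAnchor h) (W : C) :
    op02 (copairing H) W ≫ op11 h _ = op01 (η B) W ≫ op12 (coactB H B) W := by
  rw [← hh.op_one, Category.assoc, hh.op_coact, ← op_one_comul, Category.assoc]

namespace IsHopfModule

variable {M : C} {φ : M ⊗ B ⟶ M} {ρ : M ⟶ M ⊗ H}

lemma op_coact_counit (hM : IsRightComodule H ρ) (W : C) :
    op12 ρ W ≫ M ◁ op10 (ε H) W = 𝟙 _ := by
  calc _ = (ρ ≫ M ◁ ε H) ▷ W ⊗≫ 𝟙 _ := by simp only [op12, op10]; monoidal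
    _ = _ := by rw [hM.counit]; monoidal

lemma op_coact_coact (hM : IsRightComodule H ρ) (W : C) :
    op12 ρ W ≫ op12 ρ _ = op12 ρ W ≫ M ◁ op12 (δ H) W := by
  calc _ = (ρ ≫ ρ ▷ H) ▷ W ⊗≫ 𝟙 _ := by simp only [op12]; monoidal
    _ = _ := by rw [hM.coassoc]; simp only [op12]; monoidal

variable (hM : IsHopfModule h φ ρ) (W : C)
include hM

lemma op_act_one : M ◁ op01 (η B) W ≫ op21 φ W = 𝟙 _ := by
  calc _ = 𝟙 _ ⊗≫ (M ◁ η B ≫ φ) ▷ W := by simp only [op01, op21]; monoidal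
    _ = _ := by rw [hM.act_one]; monoidal

lemma op_act_coact :
    op21 φ W ≫ op12 ρ W = op12 ρ _ ≫ M ◁ H ◁ op12 (coactB H B) W ≫ M ◁ op22 (β_ H B).hom _ ≫
      op21 φ _ ≫ M ◁ op21 (μ H) W := by
  calc _ = 𝟙 _ ⊗≫ (φ ≫ ρ) ▷ W ⊗≫ 𝟙 _ := by simp only [op12, op21]; monoidal
    _ = _ := by
      rw [hM.act_coact, tensorμ, MonoidalCategory.tensorHom_def, MonoidalCategory.tensorHom_def]
      simp only [op12, op21, op22]; monoidal

lemma op_cancel_left :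
    M ◁ op12 (δ H) W ≫ M ◁ op11 h _ ≫ op21 φ _ ≫ M ◁ op11 (anti H) W ≫ M ◁ op11 h W ≫ op21 φ W =
      M ◁ op11 (PiL H) W ≫ M ◁ op11 h W ≫ op21 φ W := by
  calc _ = 𝟙 _ ⊗≫ (M ◁ δ H ≫ (α_ M H H).inv ≫ ((M ◁ h ≫ φ) ⊗ₘ (anti H ≫ h)) ≫ φ) ▷ W := by
        rw [MonoidalCategory.tensorHom_def]
        simp only [op12, op21, op11]; monoidal
    _ = _ := by rw [hM.cancel_left]; simp only [op21, op11]; monoidal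

lemma op_cancel_right :
    M ◁ op12 (δ H) W ≫ M ◁ op11 (anti H) _ ≫ M ◁ op11 h _ ≫ op21 φ _ ≫ M ◁ op11 h W ≫ op21 φ W =
      M ◁ op11 (PiR H) W ≫ M ◁ op11 h W ≫ op21 φ W := by
  calc _ = 𝟙 _ ⊗≫ (M ◁ δ H ≫ (α_ M H H).inv ≫ ((M ◁ (anti H ≫ h) ≫ φ) ⊗ₘ h) ≫ φ) ▷ W := by
        rw [MonoidalCategory.tensorHom_def]
        simp only [op12, op21, op11]; monoidal
    _ = _ := by rw [hM.cancel_right]; simp only [op21, op11]; monoidal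

omit hM [ComoduleMagma H B] in
lemma op_coinvEndo :
    op11 (coinvEndo h φ ρ) W =
      op12 ρ W ≫ M ◁ op11 (anti H) W ≫ M ◁ op11 h W ≫ op21 φ W := by
  simp only [coinvEndo, op11, op12, op21]; monoidal

lemma op_act_coact_counit :
    op12 ρ _ ≫ M ◁ H ◁ op12 (coactB H B) W ≫ M ◁ op22 (β_ H B).hom _ ≫
      op21 φ _ ≫ M ◁ op20 (pairing H) W = op21 φ W := by
  calc _ = (op12 ρ _ ≫ M ◁ H ◁ op12 (coactB H B) W ≫ M ◁ op22 (β_ H B).hom _ ≫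
        op21 φ _ ≫ M ◁ op21 (μ H) W) ≫ M ◁ op10 (ε H) _ := by
        simp [← op_mul_counit]
    _ = _ := by
      rw [← hM.op_act_coact, Category.assoc, op_coact_counit hM.isComodule, Category.comp_id]

/-- `x₀ h(Π^R(x₁)) = x`. -/
lemma op_source_act (hh : IsAnchor h) :
    op12 ρ W ≫ M ◁ op11 (PiR H) W ≫ M ◁ op11 h W ≫ op21 φ W = 𝟙 _ := by
  -- Since `Π^R(z) = 1₁ ε(z 1₂)` and `h(1₁) ⊗ 1₂ = ρ_B(1)`, the left side is the counit applied to
  -- `ρ(x 1)`.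
  calc
    _ = op12 ρ W ≫ M ◁ H ◁ op02 (copairing H) W ≫ M ◁ (op22 (β_ H H).hom _ ≫ op11 h _) ≫
          op21 φ _ ≫ M ◁ op20 (pairing H) _ := by
      rw [op_PiR]; simp
    _ = op12 ρ W ≫ M ◁ H ◁ (op02 (copairing H) W ≫ op11 h _) ≫ M ◁ op22 (β_ H B).hom _ ≫
          op21 φ _ ≫ M ◁ op20 (pairing H) _ := by
      rw [← whiskerLeft_op11_braiding]; simp
    _ = M ◁ op01 (η B) W ≫ op12 ρ _ ≫ M ◁ H ◁ op12 (coactB H B) W ≫ M ◁ op22 (β_ H B).hom _ ≫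
          op21 φ _ ≫ M ◁ op20 (pairing H) W := by
      rw [hh.op_copairing]; simp
    _ = _ := by rw [hM.op_act_coact_counit, hM.op_act_one]

/-- Every element is a product with a coinvariant: `q(x₀) h(x₁) = x`. -/
lemma op_coinvEndo_act (hh : IsAnchor h) :
    op12 ρ W ≫ op11 (coinvEndo h φ ρ) _ ≫ M ◁ op11 h W ≫ op21 φ W = 𝟙 _ := by
  calc
    _ = (op12 ρ W ≫ op12 ρ _) ≫ M ◁ op11 (anti H) _ ≫ M ◁ op11 h _ ≫ op21 φ _ ≫
          M ◁ op11 h W ≫ op21 φ W := by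
      rw [op_coinvEndo]; simp
    _ = op12 ρ W ≫ M ◁ op12 (δ H) W ≫ M ◁ op11 (anti H) _ ≫ M ◁ op11 h _ ≫ op21 φ _ ≫
          M ◁ op11 h W ≫ op21 φ W := by
      rw [op_coact_coact hM.isComodule, Category.assoc]
    _ = _ := by rw [hM.op_cancel_right, hM.op_source_act W hh]

/-- Compatibility of `ρ` with the action and colinearity of `h` give `ρ(q(x)) = x₀ h(λ(x₂)₁) ⊗ x₁
λ(x₂)₂`, whose dependence on the `H`-legs is exactly `coinvCoact`. -/
lemma op_coinvEndo_coact (hh : IsAnchor h) :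
    op11 (coinvEndo h φ ρ) W ≫ op12 ρ W =
      op12 ρ W ≫ M ◁ coinvCoact H W ≫ M ◁ op11 h _ ≫ op21 φ _ := by
  calc
    _ = (op12 ρ W ≫ op12 ρ _) ≫ M ◁ H ◁ op11 (anti H) _ ≫
          M ◁ H ◁ (op11 h _ ≫ op12 (coactB H B) W) ≫ M ◁ op22 (β_ H B).hom _ ≫
          op21 φ _ ≫ M ◁ op21 (μ H) W := by
      rw [op_coinvEndo]
      simp only [Category.assoc, hM.op_act_coact]; simp
    _ = op12 ρ W ≫ M ◁ op12 (δ H) W ≫ M ◁ H ◁ op11 (anti H) _ ≫ M ◁ H ◁ op12 (δ H) W ≫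
          M ◁ (H ◁ op11 h _ ≫ op22 (β_ H B).hom _) ≫
          op21 φ _ ≫ M ◁ op21 (μ H) W := by
      rw [op_coact_coact hM.isComodule, hh.op_coact]; simp
    _ = _ := by rw [whiskerLeft_op11_braiding, coinvCoact]; simp

/-- The coaction on the coinvariants takes values in the image of `Π̄^R`. -/
lemma op_coinvEndo_coact_PiRBar (hh : IsAnchor h) :
    op11 (coinvEndo h φ ρ) W ≫ op12 ρ W ≫ M ◁ op11 (PiRBar H) W =
      op11 (coinvEndo h φ ρ) W ≫ op12 ρ W := by
  rw [reassoc_of% hM.op_coinvEndo_coact W hh, hM.op_coinvEndo_coact W hh]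
  calc _ = op12 ρ W ≫ M ◁ (coinvCoact H W ≫ H ◁ op11 (PiRBar H) W) ≫ M ◁ op11 h _ ≫ op21 φ _ := by
        simp
    _ = _ := by rw [coinvCoact_PiRBar]

/-- `ρ(m b) = m b₀ ⊗ b₁` for coinvariant `m`. -/
lemma op_coinvEndo_act_coact (hh : IsAnchor h) :
    op11 (coinvEndo h φ ρ) _ ≫ op21 φ W ≫ op12 ρ W =
      op11 (coinvEndo h φ ρ) _ ≫ M ◁ op12 (coactB H B) W ≫ op21 φ _ := by
  -- For coinvariant `m`: `m₀ b₀ ⊗ m₁ b₁ = m₀ b₀ ⊗ Π̄^R(m₁) b₁ = m₀ b₀ ε(m₁ b₁) ⊗ b₂ = m b₀ ⊗ b₁`.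
  calc
    _ = (op11 (coinvEndo h φ ρ) _ ≫ op12 ρ _) ≫ M ◁ H ◁ op12 (coactB H B) W ≫
          M ◁ op22 (β_ H B).hom _ ≫ op21 φ _ ≫ M ◁ op21 (μ H) W := by
      rw [hM.op_act_coact]; simp
    _ = op11 (coinvEndo h φ ρ) _ ≫ op12 ρ _ ≫ M ◁ H ◁ op12 (coactB H B) W ≫
          M ◁ (op11 (PiRBar H) _ ≫ op22 (β_ H B).hom _) ≫ op21 φ _ ≫ M ◁ op21 (μ H) W := by
      rw [← hM.op_coinvEndo_coact_PiRBar _ hh]; simp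
    _ = op11 (coinvEndo h φ ρ) _ ≫ op12 ρ _ ≫ M ◁ H ◁ op12 (coactB H B) W ≫
          M ◁ op22 (β_ H B).hom _ ≫ op21 φ _ ≫ M ◁ (op11 (PiRBar H) _ ≫ op21 (μ H) W) := by
      rw [op11_braiding]; simp
    _ = op11 (coinvEndo h φ ρ) _ ≫ op12 ρ _ ≫ M ◁ H ◁ (op12 (coactB H B) W ≫ B ◁ op12 (δ H) W) ≫
          M ◁ op22 (β_ H B).hom _ ≫ op21 φ _ ≫ M ◁ op20 (pairing H) _ := by
      rw [op_PiRBar_mul]; simp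
    _ = op11 (coinvEndo h φ ρ) _ ≫ M ◁ op12 (coactB H B) W ≫
          op12 ρ _ ≫ M ◁ H ◁ op12 (coactB H B) _ ≫
          M ◁ op22 (β_ H B).hom _ ≫ op21 φ _ ≫ M ◁ op20 (pairing H) _ := by
      rw [← op_coact_coact hh.isHopfModule.isComodule]; simp
    _ = _ := by rw [hM.op_act_coact_counit]

/-- For `m` in the image of `q`, writing `m = m 1` gives `ρ(m) = m h(1₁) ⊗ 1₂`. Hence `q(m) = (m
h(1₁)) hλ(1₂) = m hΠ^L(1) = m`. -/
lemma op_coinvEndo_idem (hh : IsAnchor h) :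
    op11 (coinvEndo h φ ρ) W ≫ op11 (coinvEndo h φ ρ) W = op11 (coinvEndo h φ ρ) W := by
  have h₁ : op11 (coinvEndo h φ ρ) W ≫ op12 ρ W =
      op11 (coinvEndo h φ ρ) W ≫ M ◁ op02 (copairing H) W ≫ M ◁ op11 h _ ≫ op21 φ _ := by
    calc _ = op11 (coinvEndo h φ ρ) W ≫ (M ◁ op01 (η B) W ≫ op21 φ W) ≫ op12 ρ W := by
          rw [hM.op_act_one, Category.id_comp]
      _ = M ◁ op01 (η B) W ≫ op11 (coinvEndo h φ ρ) _ ≫ op21 φ W ≫ op12 ρ W := by simp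
      _ = op11 (coinvEndo h φ ρ) _ ≫ M ◁ (op01 (η B) W ≫ op12 (coactB H B) W) ≫ op21 φ _ := by
          rw [hM.op_coinvEndo_act_coact W hh]; simp
      _ = _ := by rw [← hh.op_copairing]; simp
  calc
    _ = (op11 (coinvEndo h φ ρ) W ≫ op12 ρ W) ≫ M ◁ op11 (anti H) W ≫ M ◁ op11 h W ≫
          op21 φ W := by
      conv_lhs => rw [op_coinvEndo (M := M) W]
      simp [op_coinvEndo]
    _ = op11 (coinvEndo h φ ρ) W ≫ M ◁ op01 (η H) W ≫ M ◁ op12 (δ H) W ≫ M ◁ op11 h _ ≫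
          op21 φ _ ≫ M ◁ op11 (anti H) W ≫ M ◁ op11 h W ≫ op21 φ W := by
      rw [h₁, ← op_one_comul]; simp
    _ = op11 (coinvEndo h φ ρ) W ≫ M ◁ ((op01 (η H) W ≫ op11 (PiL H) W) ≫ op11 h W) ≫
          op21 φ W := by
      rw [hM.op_cancel_left]; simp
    _ = _ := by rw [op_one_PiL, hh.op_one, hM.op_act_one, Category.comp_id]

lemma coinvEndo_idem (hh : IsAnchor h) :
    coinvEndo h φ ρ ≫ coinvEndo h φ ρ = coinvEndo h φ ρ := by
  apply op11_injective
  rw [op11_comp, hM.op_coinvEndo_idem _ hh]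

/-- `q(m b) = m q(b)` for coinvariant `m`. -/
lemma op_coinvEndo_act_coinvEndo (hh : IsAnchor h)
    (hq : ∀ W, M ◁ op11 (qB h) _ ≫ op21 φ _ ≫ op21 φ W =
      M ◁ op11 (qB h) _ ≫ M ◁ op21 (μ B) W ≫ op21 φ W) :
    op11 (coinvEndo h φ ρ) _ ≫ op21 φ W ≫ op11 (coinvEndo h φ ρ) W =
      op11 (coinvEndo h φ ρ) _ ≫ M ◁ op11 (qB h) W ≫ op21 φ W := by
  have hB := hh.isHopfModule
  -- Expanding `b₀` as `q(b₀) h(b₁)` makes reassociation possible: `(m (q(b₀) h(b₁))) hλ(b₂) = ((m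
  -- q(b₀)) h(b₁)) hλ(b₂) = (m q(b₀)) hΠ^L(b₁) = m (q(b₀) hΠ^L(b₁))`. The same cancellation in `B`,
  -- read backwards, then gives `m q(b)`.
  calc
    _ = (op11 (coinvEndo h φ ρ) _ ≫ op21 φ W ≫ op12 ρ W) ≫ M ◁ op11 (anti H) W ≫
          M ◁ op11 h W ≫ op21 φ W := by
      rw [op_coinvEndo W]; simp
    _ = op11 (coinvEndo h φ ρ) _ ≫ M ◁ (op12 (coactB H B) W ≫
          (op12 (coactB H B) _ ≫ op11 (qB h) _ ≫ B ◁ op11 h _ ≫ op21 (μ B) _)) ≫ op21 φ _ ≫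
          M ◁ op11 (anti H) W ≫ M ◁ op11 h W ≫ op21 φ W := by
      rw [hM.op_coinvEndo_act_coact W hh, hB.op_coinvEndo_act _ hh, Category.comp_id]; simp
    _ = op11 (coinvEndo h φ ρ) _ ≫ M ◁ (op12 (coactB H B) W ≫ op12 (coactB H B) _) ≫
          M ◁ B ◁ op11 h _ ≫ (M ◁ op11 (qB h) _ ≫ M ◁ op21 (μ B) _ ≫ op21 φ _) ≫
          M ◁ op11 (anti H) W ≫ M ◁ op11 h W ≫ op21 φ W := by
      simp
    _ = op11 (coinvEndo h φ ρ) _ ≫ M ◁ op12 (coactB H B) W ≫ M ◁ op11 (qB h) _ ≫ op21 φ _ ≫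
          M ◁ op12 (δ H) W ≫ M ◁ op11 h _ ≫ op21 φ _ ≫
          M ◁ op11 (anti H) W ≫ M ◁ op11 h W ≫ op21 φ W := by
      rw [← hq, op_coact_coact hB.isComodule]; simp
    _ = op11 (coinvEndo h φ ρ) _ ≫ M ◁ op12 (coactB H B) W ≫
          M ◁ B ◁ op11 (PiL H) _ ≫ M ◁ B ◁ op11 h _ ≫
          M ◁ op11 (qB h) _ ≫ op21 φ _ ≫ op21 φ W := by
      rw [hM.op_cancel_left]; simp
    _ = op11 (coinvEndo h φ ρ) _ ≫ M ◁ op12 (coactB H B) W ≫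
          M ◁ op11 (qB h) _ ≫ M ◁ (B ◁ op11 (PiL H) _ ≫ B ◁ op11 h _ ≫ op21 (μ B) _) ≫
          op21 φ W := by
      rw [hq]; simp
    _ = op11 (coinvEndo h φ ρ) _ ≫ M ◁ (op12 (coactB H B) W ≫ B ◁ op12 (δ H) _) ≫
          M ◁ op11 (qB h) _ ≫ M ◁ B ◁ op11 h _ ≫ M ◁ op21 (μ B) _ ≫ M ◁ B ◁ op11 (anti H) W ≫
          M ◁ B ◁ op11 h W ≫ M ◁ op21 (μ B) W ≫ op21 φ W := by
      rw [← hB.op_cancel_left]; simp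
    _ = op11 (coinvEndo h φ ρ) _ ≫ M ◁ (op12 (coactB H B) W ≫
          (op12 (coactB H B) _ ≫ op11 (qB h) _ ≫ B ◁ op11 h _ ≫ op21 (μ B) _) ≫
          B ◁ op11 (anti H) W ≫ B ◁ op11 h W ≫ op21 (μ B) W) ≫ op21 φ W := by
      rw [← op_coact_coact hB.isComodule]; simp
    _ = _ := by rw [hB.op_coinvEndo_act _ hh, Category.id_comp, ← op_coinvEndo]

end IsHopfModule

end Modules

/-! ### Coequalizers and epimorphisms under tensoring -/

section RegularEpi

lemma epi_of_isRegularEpi {C : Type u} [Category.{v} C] {Y Z : C} {f : Y ⟶ Z} (hf : IsRegularEpi f) : Epi f :=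
  hf.regularEpi.some.epi

variable {C : Type u} [Category.{v} C] [MonoidalCategory C]

/-- Preservation of coequalizers says nothing directly about plain epimorphisms. Keeping regularity
allows the tensoring to be iterated. -/
lemma isRegularEpi_whiskerRight (X : C)
    [PreservesColimitsOfShape WalkingParallelPair (tensorRight X)] {Y Z : C} {f : Y ⟶ Z}
    (hf : IsRegularEpi f) : IsRegularEpi (f ▷ X) := by
  obtain ⟨⟨r⟩⟩ := hf
  exact ⟨⟨{
    W := r.W ⊗ X
    left := r.left ▷ X
    right := r.right ▷ X
    w := by rw [← comp_whiskerRight, r.w, comp_whiskerRight]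
    isColimit := isColimitCoforkMapOfIsColimit (tensorRight X) r.w r.isColimit }⟩⟩

lemma coequalizer_whiskerRight_desc [HasCoequalizers C] (X : C)
    [PreservesColimitsOfShape WalkingParallelPair (tensorRight X)] {Y Z V : C} (f g : Y ⟶ Z)
    (k : Z ⊗ X ⟶ V) (hk : f ▷ X ≫ k = g ▷ X ≫ k) :
    ∃ d : coequalizer f g ⊗ X ⟶ V, coequalizer.π f g ▷ X ≫ d = k := by
  let l := isColimitOfHasCoequalizerOfPreservesColimit (tensorRight X) f g
  exact ⟨(Cofork.IsColimit.desc' l k hk).1, (Cofork.IsColimit.desc' l k hk).2⟩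

lemma epi_op21 {X Y Z : C} {f : X ⊗ Y ⟶ Z} {W : C} (hf : Epi (f ▷ W)) : Epi (op21 f W) := by
  rw [op21]; infer_instance

lemma epi_whiskerRight_tensor {X Y Z W : C} {f : X ⟶ Y} (hf : Epi (f ▷ Z ▷ W)) :
    Epi (f ▷ (Z ⊗ W)) := by
  rw [whiskerRight_tensor]; infer_instance

lemma epi_whiskerRight_unit {X Y : C} {f : X ⟶ Y} (hf : Epi f) : Epi (f ▷ 𝟙_ C) := by
  rw [whiskerRight_id]; infer_instance

end RegularEpi

/-! ### Coinvariants of a strong Hopf module and the isomorphism `ω` -/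

namespace StrongHopfModule

variable {C : Type u} [Category.{v} C] [MonoidalCategory C] [BraidedCategory C]
variable {H : C} [WeakHopfQuasigroup H] {B : C} [ComoduleMagma H B] {h : H ⟶ B}
  {sB : Splitting (qB h)} {M : StrongHopfModule h sB}

lemma op_act_act {Z : C} {i : Z ⟶ B} {M : C} {φ : M ⊗ B ⟶ M} {ρ : M ⟶ M ⊗ H}
    (hM : IsStrongHopfModule h i φ ρ) (W : C) :
    M ◁ op11 i _ ≫ op21 φ _ ≫ op21 φ W = M ◁ op11 i _ ≫ M ◁ op21 (μ B) W ≫ op21 φ W := by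
  calc _ = 𝟙 _ ⊗≫ ((M ◁ i ≫ φ) ▷ B ≫ φ) ▷ W := by simp only [op11, op21]; monoidal
    _ = _ := by rw [hM.act_act]; simp only [op11, op21]; monoidal

lemma op_strongOne {Z : C} {i : Z ⟶ B} (h₁ : StrongOne i) (W : C) :
    B ◁ op11 i _ ≫ op21 (μ B) _ ≫ op21 (μ B) W =
      B ◁ op11 i _ ≫ B ◁ op21 (μ B) W ≫ op21 (μ B) W := by
  calc _ = 𝟙 _ ⊗≫ ((B ◁ i ≫ μ B) ▷ B ≫ μ B) ▷ W := by simp only [op11, op21]; monoidal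
    _ = _ := by rw [h₁]; simp only [op11, op21]; monoidal

lemma op_strongTwo {Z : C} {i : Z ⟶ B} (h₂ : StrongTwo i) (W : C) :
    op11 i _ ≫ B ◁ op21 (μ B) W ≫ op21 (μ B) W =
      op11 i _ ≫ op21 (μ B) _ ≫ op21 (μ B) W := by
  calc _ = 𝟙 _ ⊗≫ ((i ⊗ₘ μ B) ≫ μ B) ▷ W := by
        rw [MonoidalCategory.tensorHom_def]; simp only [op11, op21]; monoidal
    _ = _ := by rw [h₂]; simp only [op11, op21]; monoidal

section Coinvariants

variable (sM : Splitting M.q) (W : C)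

omit [BraidedCategory C] in
lemma op_p_i {Y : C} {q : Y ⟶ Y} (s : Splitting q) :
    op11 s.p W ≫ op11 s.i W = op11 q W := by
  rw [← op11_comp, s.p_i]

omit [BraidedCategory C] in
lemma op_i_p {Y : C} {q : Y ⟶ Y} (s : Splitting q) :
    op11 s.i W ≫ op11 s.p W = 𝟙 _ := by
  rw [← op11_comp, s.i_p]; simp [op11]

omit [BraidedCategory C] in
lemma op_i_q {Y : C} {q : Y ⟶ Y} (s : Splitting q) :
    op11 s.i W ≫ op11 q W = op11 s.i W := by
  rw [← op_p_i, reassoc_of% op_i_p]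

lemma op_i_act_coact (hh : IsAnchor h) :
    op11 sM.i _ ≫ op21 M.act W ≫ op12 M.coact W =
      op11 sM.i _ ≫ M.X ◁ op12 (coactB H B) W ≫ op21 M.act _ := by
  rw [← op_i_q, Category.assoc, M.isStrong.isHopfModule.op_coinvEndo_act_coact W hh,
    Category.assoc]

lemma op_i_act_q (hh : IsAnchor h) :
    op11 sM.i _ ≫ op21 M.act W ≫ op11 M.q W =
      op11 sM.i _ ≫ M.X ◁ op11 (qB h) W ≫ op21 M.act W := by
  rw [← op_i_q, Category.assoc,
    M.isStrong.isHopfModule.op_coinvEndo_act_coinvEndo W hh, Category.assoc]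
  intro W
  -- Associativity around `q_B` reduces to associativity around `i_B`, as `q_B` factors through
  -- `i_B`.
  rw [← op_p_i _ sB]
  simp only [whiskerLeft_comp, Category.assoc]
  rw [op_act_act M.isStrong]

lemma op_coinvAct :
    op21 (coinvAct sM) W = op11 sM.i _ ≫ M.X ◁ op11 sB.i W ≫ op21 M.act W ≫ op11 sM.p W := by
  rw [coinvAct, MonoidalCategory.tensorHom_def]
  simp only [op11, op21]; monoidal

/-- The product `m i(z)` is already coinvariant: `q(m i(z)) = m q(i(z)) = m i(z)`. -/
lemma op_coinvAct_i (hh : IsAnchor h) :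
    op21 (coinvAct sM) W ≫ op11 sM.i W = op11 sM.i _ ≫ M.X ◁ op11 sB.i W ≫ op21 M.act W := by
  calc _ = sM.Z ◁ op11 sB.i W ≫ op11 sM.i _ ≫ op21 M.act W ≫ op11 M.q W := by
        rw [op_coinvAct, ← op_p_i _ sM]; simp
    _ = sM.Z ◁ (op11 sB.i W ≫ op11 (qB h) W) ≫ op11 sM.i _ ≫ op21 M.act W := by
        rw [op_i_act_q sM W hh]; simp
    _ = _ := by rw [op_i_q]; simp

lemma coinvAct_i (hh : IsAnchor h) :
    coinvAct sM ≫ sM.i = (sM.i ⊗ₘ sB.i) ≫ M.act := by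
  apply op21_injective
  calc _ = op21 (coinvAct sM) _ ≫ op11 sM.i _ := by simp [op21, op11]
    _ = _ := by
      rw [op_coinvAct_i sM _ hh, MonoidalCategory.tensorHom_def]
      simp only [op11, op21]; monoidal

lemma op_i_act_p (hh : IsAnchor h) :
    op11 sM.i _ ≫ op21 M.act W ≫ op11 sM.p W =
      sM.Z ◁ op11 sB.p W ≫ op21 (coinvAct sM) W := by
  calc _ = op11 sM.i _ ≫ (op21 M.act W ≫ op11 M.q W) ≫ op11 sM.p W := by
        rw [← op_p_i _ sM, Category.assoc, Category.assoc, op_i_p, Category.comp_id]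
    _ = op11 sM.i _ ≫ M.X ◁ (op11 sB.p W ≫ op11 sB.i W) ≫ op21 M.act W ≫ op11 sM.p W := by
        rw [op_p_i, Category.assoc, reassoc_of% op_i_act_q sM W hh]
    _ = _ := by rw [op_coinvAct]; simp

/-- Coequalization of `T¹` and `T²` can be tested on right-nested tensor products. -/
lemma T_coequalizes {Y : C} (k : sM.Z ⊗ B ⟶ Y)
    (hk : op21 (coinvAct sM) _ ≫ op21 k (𝟙_ C) =
      sM.Z ◁ op11 sB.i _ ≫ sM.Z ◁ op21 (μ B) _ ≫ op21 k _) :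
    T₁ sM ≫ k = T₂ sM ≫ k := by
  have h₁ : op21 (coinvAct sM) _ ≫ op21 k (𝟙_ C) =
      (α_ _ _ _).inv ≫ (α_ _ _ _).inv ≫ (T₁ sM ≫ k) ▷ 𝟙_ C := by
    rw [T₁]; simp only [op21]; monoidal
  have h₂ : sM.Z ◁ op11 sB.i _ ≫ sM.Z ◁ op21 (μ B) _ ≫ op21 k (𝟙_ C) =
      (α_ _ _ _).inv ≫ (α_ _ _ _).inv ≫ (T₂ sM ≫ k) ▷ 𝟙_ C := by
    rw [T₂]; simp only [op21, op11]; monoidal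
  rw [h₁, h₂, cancel_epi, cancel_epi] at hk
  simpa using hk

lemma op_T_condition {Y : C} (k : sM.Z ⊗ B ⟶ Y) (hk : T₁ sM ≫ k = T₂ sM ≫ k) :
    op21 (coinvAct sM) _ ≫ op21 k W =
      sM.Z ◁ op11 sB.i _ ≫ sM.Z ◁ op21 (μ B) _ ≫ op21 k W := by
  calc _ = (α_ _ _ _).inv ≫ (α_ _ _ _).inv ≫ (T₁ sM ≫ k) ▷ W := by
        rw [T₁]; simp only [op21]; monoidal
    _ = _ := by rw [hk, T₂]; simp only [op21, op11]; monoidal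

end Coinvariants

section Tensor

variable [HasCoequalizers C] (sM : Splitting M.q) (W : C)

lemma op_n_condition :
    op21 (coinvAct sM) _ ≫ op21 (n sM) W =
      sM.Z ◁ op11 sB.i _ ≫ sM.Z ◁ op21 (μ B) _ ≫ op21 (n sM) W :=
  op_T_condition sM W _ (coequalizer.condition _ _)

lemma isRegularEpi_n : IsRegularEpi (n sM) :=
  ⟨⟨{ W := _
      left := T₁ sM
      right := T₂ sM
      w := coequalizer.condition _ _
      isColimit := coequalizerIsCoequalizer _ _ }⟩⟩

lemma epi_op21_n_unit : Epi (op21 (n sM) (𝟙_ C)) :=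
  epi_op21 (epi_whiskerRight_unit (epi_of_isRegularEpi (isRegularEpi_n sM)))

lemma epi_op21_n (X : C) [PreservesColimitsOfShape WalkingParallelPair (tensorRight X)] :
    Epi (op21 (n sM) (X ⊗ 𝟙_ C)) :=
  epi_op21 (epi_whiskerRight_tensor (epi_whiskerRight_unit
    (epi_of_isRegularEpi (isRegularEpi_whiskerRight X (isRegularEpi_n sM)))))

/-- Tensoring with the coinvariants is not assumed to preserve coequalizers, but they are a retract
of `B`. Following `n ⊗ B ⊗ B` by the split epimorphism induced by `p_B` gives an epimorphism that
factors through the required map. -/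
lemma epi_op21_n_coinv [PreservesColimitsOfShape WalkingParallelPair (tensorRight B)] :
    Epi (op21 (n sM) (sB.Z ⊗ B ⊗ 𝟙_ C)) := by
  have : Epi (op21 (n sM) (B ⊗ B ⊗ 𝟙_ C)) :=
    epi_op21 (epi_whiskerRight_tensor (epi_whiskerRight_tensor (epi_whiskerRight_unit
      (epi_of_isRegularEpi
        (isRegularEpi_whiskerRight B (isRegularEpi_whiskerRight B (isRegularEpi_n sM)))))))
  have hp : Epi (tensorObj sM ◁ op11 sB.p (B ⊗ 𝟙_ C)) := by
    refine @SplitEpi.epi _ _ _ _ _ ⟨tensorObj sM ◁ op11 sB.i _, ?_⟩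
    rw [← whiskerLeft_comp, op_i_p]; simp
  have he : Epi (op21 (n sM) (B ⊗ B ⊗ 𝟙_ C) ≫ tensorObj sM ◁ op11 sB.p (B ⊗ 𝟙_ C)) := epi_comp _ _
  rw [← op21_exchange] at he
  exact @epi_of_epi C _ _ _ _ _ _ he

/-- The isomorphism `ω` determined by `ω ∘ n = φ ∘ (i ⊗ B)`. -/
lemma exists_omega (hh : IsAnchor h) :
    ∃ ω : tensorObj sM ≅ M.X, n sM ≫ ω.hom = sM.i ▷ B ≫ M.act ∧
      ω.inv = M.coact ≫ (sM.p ⊗ₘ h) ≫ n sM := by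
  have hk : ∀ W, op21 (sM.i ▷ B ≫ M.act) W = op11 sM.i _ ≫ op21 M.act W := by
    intro W; simp only [op21, op11]; monoidal
  -- This is `(m i(z)) b = m (i(z) b)`, the partial associativity of the action.
  have hT : T₁ sM ≫ sM.i ▷ B ≫ M.act = T₂ sM ≫ sM.i ▷ B ≫ M.act := by
    apply T_coequalizes
    rw [hk, reassoc_of% op_coinvAct_i sM _ hh, op_act_act M.isStrong]
    simp
  obtain ⟨ω, hω⟩ : ∃ ω : tensorObj sM ⟶ M.X, n sM ≫ ω = sM.i ▷ B ≫ M.act :=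
    ⟨coequalizer.desc _ hT, coequalizer.π_desc _ _⟩
  have opω : ∀ W, op21 (n sM) W ≫ op11 ω W = op11 sM.i _ ≫ op21 M.act W := by
    intro W
    rw [← hk, ← hω]; simp only [op21, op11]; monoidal
  have opι : ∀ W, op11 (M.coact ≫ (sM.p ⊗ₘ h) ≫ n sM) W =
      op12 M.coact W ≫ op11 sM.p _ ≫ sM.Z ◁ op11 h W ≫ op21 (n sM) W := by
    intro W
    rw [MonoidalCategory.tensorHom_def]; simp only [op21, op11, op12]; monoidal
  refine ⟨⟨ω, M.coact ≫ (sM.p ⊗ₘ h) ≫ n sM, ?_, ?_⟩, hω, rfl⟩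
  · have := epi_op21_n_unit sM
    apply op11_injective
    rw [op11_comp, ← cancel_epi (op21 (n sM) (𝟙_ C)), reassoc_of% opω, opι]
    -- The image of `m ⊗ b` is `p(m b₀) ⊗ h(b₁)`, which is `m · p(b₀) ⊗ h(b₁)`. Moving `p(b₀)`
    -- across the tensor product leaves `m ⊗ q(b₀) h(b₁) = m ⊗ b`.
    calc
      _ = (op11 sM.i _ ≫ op21 M.act _ ≫ op12 M.coact _) ≫ op11 sM.p _ ≫ sM.Z ◁ op11 h _ ≫
            op21 (n sM) _ := by simp
      _ = sM.Z ◁ op12 (coactB H B) _ ≫ (op11 sM.i _ ≫ op21 M.act _ ≫ op11 sM.p _) ≫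
            sM.Z ◁ op11 h _ ≫ op21 (n sM) _ := by
        rw [op_i_act_coact sM _ hh]; simp
      _ = sM.Z ◁ op12 (coactB H B) _ ≫ sM.Z ◁ op11 sB.p _ ≫ sM.Z ◁ sB.Z ◁ op11 h _ ≫
            op21 (coinvAct sM) _ ≫ op21 (n sM) _ := by
        rw [op_i_act_p sM _ hh]; simp
      _ = sM.Z ◁ (op12 (coactB H B) _ ≫ (op11 sB.p _ ≫ op11 sB.i _) ≫ B ◁ op11 h _ ≫
            op21 (μ B) _) ≫ op21 (n sM) _ := by
        rw [op_n_condition]; simp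
      _ = _ := by
        rw [op_p_i, hh.isHopfModule.op_coinvEndo_act _ hh]; simp [op11]
  · apply op11_injective
    rw [op11_comp, opι]
    -- The other composite sends `x` to `q(x₀) h(x₁) = x`.
    calc
      _ = op12 M.coact _ ≫ op11 sM.p _ ≫ sM.Z ◁ op11 h _ ≫ op21 (n sM) _ ≫ op11 ω _ := by simp
      _ = op12 M.coact _ ≫ (op11 sM.p _ ≫ op11 sM.i _) ≫ M.X ◁ op11 h _ ≫ op21 M.act _ := by
        rw [opω]; simp
      _ = _ := by
        rw [op_p_i, M.isStrong.isHopfModule.op_coinvEndo_act _ hh]; simp [op11]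

lemma op_n_omega {ω : tensorObj sM ≅ M.X} (hω : n sM ≫ ω.hom = sM.i ▷ B ≫ M.act) :
    op21 (n sM) W ≫ op11 ω.hom W = op11 sM.i _ ≫ op21 M.act W := by
  calc _ = (α_ _ _ _).inv ≫ (n sM ≫ ω.hom) ▷ W := by simp [op21, op11]
    _ = _ := by rw [hω]; simp only [op21, op11]; monoidal

/-- As `n` is epi, its defining equation determines `ω`, so every such isomorphism has the explicit
inverse found above. -/
lemma op_omega_inv (hh : IsAnchor h) {ω : tensorObj sM ≅ M.X}
    (hω : n sM ≫ ω.hom = sM.i ▷ B ≫ M.act) :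
    op11 ω.inv W = op12 M.coact W ≫ op11 sM.p _ ≫ sM.Z ◁ op11 h W ≫ op21 (n sM) W := by
  obtain ⟨ω', hω', hi⟩ := exists_omega sM hh
  have : Epi (n sM) := epi_of_isRegularEpi (isRegularEpi_n sM)
  have e : ω = ω' := by
    ext
    rw [← cancel_epi (n sM), hω, hω']
  rw [e, hi, MonoidalCategory.tensorHom_def]
  simp only [op21, op11, op12]; monoidal

end Tensor

end StrongHopfModule

/-! ### The induced Hopf module structure on the tensor product -/

namespace StrongHopfModule

variable {C : Type u} [Category.{v} C] [MonoidalCategory C] [BraidedCategory C]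
variable {H : C} [WeakHopfQuasigroup H] {B : C} [ComoduleMagma H B] {h : H ⟶ B}
  {sB : Splitting (qB h)} {M : StrongHopfModule h sB}
variable [HasCoequalizers C] (sM : Splitting M.q) (W : C)

/-- The product descends because `i(z)(b c) = (i(z) b) c`. The factorization lives on `n ⊗ B`, which
is where preservation by `- ⊗ B` enters. -/
lemma existsUnique_inducedAction [PreservesColimitsOfShape WalkingParallelPair (tensorRight B)]
    (h₂ : StrongTwo sB.i) : ∃! φ, IsInducedAction sM φ := by
  have hT : T₁ sM ▷ B ≫ (α_ sM.Z B B).hom ≫ sM.Z ◁ μ B ≫ n sM =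
      T₂ sM ▷ B ≫ (α_ sM.Z B B).hom ≫ sM.Z ◁ μ B ≫ n sM := by
    have e : sM.Z ◁ sB.Z ◁ op21 (μ B) (𝟙_ C) ≫ op21 (coinvAct sM) _ ≫ op21 (n sM) _ =
        sM.Z ◁ op11 sB.i _ ≫ sM.Z ◁ op21 (μ B) _ ≫ sM.Z ◁ op21 (μ B) _ ≫ op21 (n sM) _ := by
      rw [op_n_condition]
      calc _ = sM.Z ◁ (op11 sB.i _ ≫ B ◁ op21 (μ B) _ ≫ op21 (μ B) _) ≫ op21 (n sM) _ := by simp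
        _ = _ := by rw [op_strongTwo h₂]; simp
    have h₁ : sM.Z ◁ sB.Z ◁ op21 (μ B) (𝟙_ C) ≫ op21 (coinvAct sM) _ ≫ op21 (n sM) _ =
        𝟙 _ ⊗≫ (T₁ sM ▷ B ≫ (α_ sM.Z B B).hom ≫ sM.Z ◁ μ B ≫ n sM) ▷ 𝟙_ C := by
      rw [op21_exchange_assoc, T₁]; simp only [op21]; monoidal
    have h₃ : sM.Z ◁ op11 sB.i _ ≫ sM.Z ◁ op21 (μ B) _ ≫ sM.Z ◁ op21 (μ B) (𝟙_ C) ≫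
          op21 (n sM) _ =
        𝟙 _ ⊗≫ (T₂ sM ▷ B ≫ (α_ sM.Z B B).hom ≫ sM.Z ◁ μ B ≫ n sM) ▷ 𝟙_ C := by
      rw [T₂]; simp only [op21, op11]; monoidal
    rw [h₁, h₃] at e
    rw [← cancel_mono (ρ_ _).inv]
    simpa [monoidalComp] using e
  obtain ⟨φ, hφ⟩ : ∃ φ, IsInducedAction sM φ := coequalizer_whiskerRight_desc B _ _ _ hT
  have : Epi (n sM ▷ B) := epi_of_isRegularEpi (isRegularEpi_whiskerRight B (isRegularEpi_n sM))
  refine ⟨φ, hφ, fun φ' hφ' => ?_⟩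
  rw [← cancel_epi (n sM ▷ B)]
  exact hφ'.trans hφ.symm

/-- The coaction descends because `ρ_B(i(z) b) = i(z) b₀ ⊗ b₁`, the coinvariance property applied to
`B` as a module over itself. -/
lemma existsUnique_inducedCoaction (hh : IsAnchor h) : ∃! ρ, IsInducedCoaction sM ρ := by
  have hk : ∀ W, op21 (sM.Z ◁ coactB H B ≫ (α_ sM.Z B H).inv ≫ n sM ▷ H) W ≫ (α_ _ _ _).hom =
      sM.Z ◁ op12 (coactB H B) W ≫ op21 (n sM) _ := by
    intro W; simp only [op21, op12]; monoidal
  have hT : T₁ sM ≫ sM.Z ◁ coactB H B ≫ (α_ sM.Z B H).inv ≫ n sM ▷ H =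
      T₂ sM ≫ sM.Z ◁ coactB H B ≫ (α_ sM.Z B H).inv ≫ n sM ▷ H := by
    apply T_coequalizes
    rw [← cancel_mono (α_ _ _ _).hom]
    simp only [Category.assoc, hk]
    calc _ = sM.Z ◁ sB.Z ◁ op12 (coactB H B) _ ≫ op21 (coinvAct sM) _ ≫ op21 (n sM) _ := by simp
      _ = sM.Z ◁ (op11 sB.i _ ≫ B ◁ op12 (coactB H B) _ ≫ op21 (μ B) _) ≫ op21 (n sM) _ := by
        rw [op_n_condition]; simp
      _ = sM.Z ◁ ((op11 sB.i _ ≫ op11 (qB h) _) ≫ B ◁ op12 (coactB H B) _ ≫ op21 (μ B) _) ≫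
            op21 (n sM) _ := by rw [op_i_q]
      _ = sM.Z ◁ ((op11 sB.i _ ≫ op11 (qB h) _) ≫ op21 (μ B) _ ≫ op12 (coactB H B) _) ≫
            op21 (n sM) _ := by
        rw [Category.assoc, Category.assoc, hh.isHopfModule.op_coinvEndo_act_coact _ hh]
      _ = _ := by rw [op_i_q]; simp
  have : Epi (n sM) := epi_of_isRegularEpi (isRegularEpi_n sM)
  obtain ⟨ρ, hρ⟩ : ∃ ρ, IsInducedCoaction sM ρ := ⟨coequalizer.desc _ hT, coequalizer.π_desc _ _⟩
  refine ⟨ρ, hρ, fun ρ' hρ' => ?_⟩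
  rw [← cancel_epi (n sM)]
  exact hρ'.trans hρ.symm

section Induced

variable {sM} {φ : tensorObj sM ⊗ B ⟶ tensorObj sM} {ρ : tensorObj sM ⟶ tensorObj sM ⊗ H}

lemma IsInducedAction.op (hφ : IsInducedAction sM φ) :
    op21 (n sM) _ ≫ op21 φ W = sM.Z ◁ op21 (μ B) W ≫ op21 (n sM) W := by
  calc _ = 𝟙 _ ⊗≫ (n sM ▷ B ≫ φ) ▷ W := by simp only [op21]; monoidal
    _ = _ := by rw [hφ]; simp only [op21]; monoidal

lemma IsInducedCoaction.op (hρ : IsInducedCoaction sM ρ) :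
    op21 (n sM) W ≫ op12 ρ W = sM.Z ◁ op12 (coactB H B) W ≫ op21 (n sM) _ := by
  calc _ = 𝟙 _ ⊗≫ (n sM ≫ ρ) ▷ W ⊗≫ 𝟙 _ := by simp only [op21, op12]; monoidal
    _ = _ := by rw [hρ]; simp only [op21, op12]; monoidal

lemma isRightComodule_induced (hB : IsRightComodule H (coactB H B))
    (hρ : IsInducedCoaction sM ρ) : IsRightComodule H ρ := by
  have := epi_op21_n_unit sM
  constructor
  · rw [← cancel_mono (ρ_ (tensorObj sM)).hom]
    apply op11_injective
    rw [← cancel_epi (op21 (n sM) _)]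
    calc _ = (op21 (n sM) _ ≫ op12 ρ _) ≫ tensorObj sM ◁ op10 (ε H) (𝟙_ C) := by
          simp only [op21, op11, op12, op10]; monoidal
      _ = sM.Z ◁ (op12 (coactB H B) _ ≫ B ◁ op10 (ε H) (𝟙_ C)) ≫ op21 (n sM) _ := by
          rw [hρ.op]; simp
      _ = _ := by rw [IsHopfModule.op_coact_counit hB]; simp [op11]
  · rw [← cancel_mono (α_ _ _ _).hom]
    apply op12_injective
    rw [← cancel_epi (op21 (n sM) _), ← cancel_mono (tensorObj sM ◁ (α_ H H (𝟙_ C)).hom)]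
    calc _ = (op21 (n sM) _ ≫ op12 ρ (𝟙_ C)) ≫ op12 ρ _ := by
          simp only [op21, op12]; monoidal
      _ = sM.Z ◁ op12 (coactB H B) _ ≫ op21 (n sM) _ ≫ op12 ρ _ := by
          rw [hρ.op, Category.assoc]
      _ = sM.Z ◁ (op12 (coactB H B) _ ≫ op12 (coactB H B) _) ≫ op21 (n sM) _ := by
          rw [hρ.op]; simp
      _ = sM.Z ◁ op12 (coactB H B) _ ≫ sM.Z ◁ B ◁ op12 (δ H) _ ≫ op21 (n sM) _ := by
          rw [IsHopfModule.op_coact_coact hB]; simp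
      _ = (op21 (n sM) _ ≫ op12 ρ (𝟙_ C)) ≫ tensorObj sM ◁ op12 (δ H) _ := by
          rw [hρ.op]; simp
      _ = _ := by simp only [op21, op12]; monoidal

/-- Each axiom is tested after `n`, where it becomes the corresponding property of `B` in the second
factor. Partial associativity becomes `StrongOne`, and the cancellation laws become those of the
anchor. -/
lemma isStrongHopfModule_induced
    [PreservesColimitsOfShape WalkingParallelPair (tensorRight B)]
    [PreservesColimitsOfShape WalkingParallelPair (tensorRight H)] (hh : IsAnchor h) (h₁ : StrongOne sB.i)
    (hφ : IsInducedAction sM φ) (hρ : IsInducedCoaction sM ρ) :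
    IsStrongHopfModule h sB.i φ ρ where
  isComodule := isRightComodule_induced hh.isHopfModule.isComodule hρ
  act_one := by
    have := epi_op21_n_unit sM
    rw [← cancel_epi (ρ_ (tensorObj sM)).inv]
    apply op11_injective
    rw [← cancel_epi (op21 (n sM) _)]
    calc _ = (op21 (n sM) _ ≫ _ ◁ op01 (η B) (𝟙_ C)) ≫ op21 φ _ := by
          simp only [op21, op11, op01]; monoidal
      _ = sM.Z ◁ B ◁ op01 (η B) _ ≫ op21 (n sM) _ ≫ op21 φ (𝟙_ C) := by simp
      _ = sM.Z ◁ (B ◁ op01 (η B) _ ≫ op21 (μ B) _) ≫ op21 (n sM) _ := by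
          rw [hφ.op]; simp
      _ = _ := by rw [op_mul_one]; simp [op11]
  act_act := by
    have := epi_op21_n_coinv sM
    have e : tensorObj sM ◁ op11 sB.i _ ≫ op21 φ _ ≫ op21 φ (𝟙_ C) =
        tensorObj sM ◁ op11 sB.i _ ≫ _ ◁ op21 (μ B) _ ≫ op21 φ (𝟙_ C) := by
      rw [← cancel_epi (op21 (n sM) _)]
      calc _ = sM.Z ◁ B ◁ op11 sB.i _ ≫ (op21 (n sM) _ ≫ op21 φ _) ≫ op21 φ (𝟙_ C) := by simp
        _ = sM.Z ◁ B ◁ op11 sB.i _ ≫ sM.Z ◁ op21 (μ B) _ ≫ op21 (n sM) _ ≫ op21 φ (𝟙_ C) := by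
          rw [hφ.op, Category.assoc]
        _ = sM.Z ◁ (B ◁ op11 sB.i _ ≫ op21 (μ B) _ ≫ op21 (μ B) _) ≫ op21 (n sM) _ := by
          rw [hφ.op]; simp
        _ = sM.Z ◁ B ◁ op11 sB.i _ ≫ sM.Z ◁ B ◁ op21 (μ B) _ ≫ op21 (n sM) _ ≫
              op21 φ (𝟙_ C) := by
          rw [op_strongOne h₁, hφ.op]; simp
        _ = _ := by simp
    have e₁ : tensorObj sM ◁ op11 sB.i _ ≫ op21 φ _ ≫ op21 φ (𝟙_ C) =
        𝟙 _ ⊗≫ ((tensorObj sM ◁ sB.i ≫ φ) ▷ B ≫ φ) ▷ 𝟙_ C := by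
      simp only [op11, op21]; monoidal
    have e₂ : tensorObj sM ◁ op11 sB.i _ ≫ _ ◁ op21 (μ B) _ ≫ op21 φ (𝟙_ C) =
        𝟙 _ ⊗≫ ((α_ _ _ _).hom ≫ _ ◁ (sB.i ▷ B ≫ μ B) ≫ φ) ▷ 𝟙_ C := by
      simp only [op11, op21]; monoidal
    rw [e₁, e₂] at e
    rw [← cancel_mono (ρ_ _).inv]
    simpa [monoidalComp] using e
  act_coact := by
    have := epi_op21_n sM B
    apply op22_injective
    rw [← cancel_epi (op21 (n sM) _)]
    calc
      _ = (op21 (n sM) _ ≫ op21 φ _) ≫ op12 ρ (𝟙_ C) := by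
        simp only [op21, op12, op22]; monoidal
      _ = sM.Z ◁ op21 (μ B) _ ≫ op21 (n sM) _ ≫ op12 ρ (𝟙_ C) := by
        rw [hφ.op, Category.assoc]
      _ = sM.Z ◁ (op21 (μ B) _ ≫ op12 (coactB H B) _) ≫ op21 (n sM) _ := by
        rw [hρ.op]; simp
      _ = sM.Z ◁ op12 (coactB H B) _ ≫ sM.Z ◁ B ◁ H ◁ op12 (coactB H B) _ ≫
            sM.Z ◁ B ◁ op22 (β_ H B).hom _ ≫ sM.Z ◁ op21 (μ B) _ ≫ op21 (n sM) _ ≫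
            _ ◁ op21 (μ H) (𝟙_ C) := by
        rw [hh.isHopfModule.op_act_coact]; simp
      _ = sM.Z ◁ op12 (coactB H B) _ ≫ op21 (n sM) _ ≫
            _ ◁ H ◁ op12 (coactB H B) _ ≫
            _ ◁ op22 (β_ H B).hom _ ≫ op21 φ _ ≫
            _ ◁ op21 (μ H) (𝟙_ C) := by
        rw [← reassoc_of% hφ.op]; simp
      _ = op21 (n sM) _ ≫ op12 ρ _ ≫ _ ◁ H ◁ op12 (coactB H B) _ ≫
            _ ◁ op22 (β_ H B).hom _ ≫ op21 φ _ ≫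
            _ ◁ op21 (μ H) (𝟙_ C) := by
        rw [← reassoc_of% hρ.op]
      _ = _ := by
        rw [tensorμ, MonoidalCategory.tensorHom_def, MonoidalCategory.tensorHom_def]
        simp only [op21, op12, op22]; monoidal
  cancel_left := by
    have := epi_op21_n sM H
    apply op21_injective
    rw [← cancel_epi (op21 (n sM) _)]
    calc
      _ = op21 (n sM) _ ≫ _ ◁ op12 (δ H) _ ≫ _ ◁ op11 h _ ≫ op21 φ _ ≫
            _ ◁ op11 (anti H) _ ≫ _ ◁ op11 h _ ≫ op21 φ (𝟙_ C) := by
        rw [MonoidalCategory.tensorHom_def]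
        simp only [op12, op21, op11]; monoidal
      _ = sM.Z ◁ B ◁ op12 (δ H) _ ≫ sM.Z ◁ B ◁ op11 h _ ≫ (op21 (n sM) _ ≫ op21 φ _) ≫
            _ ◁ op11 (anti H) _ ≫ _ ◁ op11 h _ ≫ op21 φ (𝟙_ C) := by
        simp
      _ = sM.Z ◁ B ◁ op12 (δ H) _ ≫ sM.Z ◁ B ◁ op11 h _ ≫ sM.Z ◁ op21 (μ B) _ ≫
            sM.Z ◁ B ◁ op11 (anti H) _ ≫ sM.Z ◁ B ◁ op11 h _ ≫ op21 (n sM) _ ≫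
            op21 φ (𝟙_ C) := by
        rw [hφ.op]; simp
      _ = sM.Z ◁ (B ◁ op12 (δ H) _ ≫ B ◁ op11 h _ ≫ op21 (μ B) _ ≫ B ◁ op11 (anti H) _ ≫
            B ◁ op11 h _ ≫ op21 (μ B) _) ≫ op21 (n sM) _ := by
        rw [hφ.op]; simp
      _ = sM.Z ◁ B ◁ op11 (PiL H) _ ≫ sM.Z ◁ B ◁ op11 h _ ≫ op21 (n sM) _ ≫
            op21 φ (𝟙_ C) := by
        rw [hh.isHopfModule.op_cancel_left, hφ.op]; simp
      _ = op21 (n sM) _ ≫ _ ◁ op11 (PiL H) _ ≫ _ ◁ op11 h _ ≫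
            op21 φ (𝟙_ C) := by simp
      _ = _ := by simp only [op21, op11]; monoidal
  cancel_right := by
    have := epi_op21_n sM H
    apply op21_injective
    rw [← cancel_epi (op21 (n sM) _)]
    calc
      _ = op21 (n sM) _ ≫ _ ◁ op12 (δ H) _ ≫ _ ◁ op11 (anti H) _ ≫
            _ ◁ op11 h _ ≫ op21 φ _ ≫ _ ◁ op11 h _ ≫ op21 φ (𝟙_ C) := by
        rw [MonoidalCategory.tensorHom_def]
        simp only [op12, op21, op11]; monoidal
      _ = sM.Z ◁ B ◁ op12 (δ H) _ ≫ sM.Z ◁ B ◁ op11 (anti H) _ ≫ sM.Z ◁ B ◁ op11 h _ ≫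
            (op21 (n sM) _ ≫ op21 φ _) ≫ _ ◁ op11 h _ ≫ op21 φ (𝟙_ C) := by
        simp
      _ = sM.Z ◁ B ◁ op12 (δ H) _ ≫ sM.Z ◁ B ◁ op11 (anti H) _ ≫ sM.Z ◁ B ◁ op11 h _ ≫
            sM.Z ◁ op21 (μ B) _ ≫ sM.Z ◁ B ◁ op11 h _ ≫ op21 (n sM) _ ≫ op21 φ (𝟙_ C) := by
        rw [hφ.op]; simp
      _ = sM.Z ◁ (B ◁ op12 (δ H) _ ≫ B ◁ op11 (anti H) _ ≫ B ◁ op11 h _ ≫ op21 (μ B) _ ≫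
            B ◁ op11 h _ ≫ op21 (μ B) _) ≫ op21 (n sM) _ := by
        rw [hφ.op]; simp
      _ = sM.Z ◁ B ◁ op11 (PiR H) _ ≫ sM.Z ◁ B ◁ op11 h _ ≫ op21 (n sM) _ ≫
            op21 φ (𝟙_ C) := by
        rw [hh.isHopfModule.op_cancel_right, hφ.op]; simp
      _ = op21 (n sM) _ ≫ _ ◁ op11 (PiR H) _ ≫ _ ◁ op11 h _ ≫
            op21 φ (𝟙_ C) := by simp
      _ = _ := by simp only [op21, op11]; monoidal

end Induced

end StrongHopfModule

/-- Idempotents have an image in an idempotent complete category. -/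
lemma exists_splitting {C : Type u} [Category.{v} C] [IsIdempotentComplete C] {Y : C} (q : Y ⟶ Y)
    (hq : q ≫ q = q) : Nonempty (Splitting q) := by
  obtain ⟨Z, i, p, h₁, h₂⟩ := IsIdempotentComplete.idempotents_split Y q hq
  exact ⟨⟨Z, p, i, h₂, h₁⟩⟩

/-! ### The deformed action and the isomorphism of Hopf modules -/

namespace StrongHopfModule

variable {C : Type u} [Category.{v} C] [MonoidalCategory C] [BraidedCategory C]
variable {H : C} [WeakHopfQuasigroup H] {B : C} [ComoduleMagma H B] {h : H ⟶ B}
  {sB : Splitting (qB h)} {M : StrongHopfModule h sB}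
variable [HasCoequalizers C] (W : C)

/-- A deformed action is given by `x ⊗ b ↦ q(x₀) (h(x₁) b)`. -/
lemma IsDeformedAction.op (hh : IsAnchor h) {ψ : M.X ⊗ B ⟶ M.X} (hψ : M.IsDeformedAction ψ) :
    op21 ψ W = op12 M.coact _ ≫ op11 M.q _ ≫ M.X ◁ op11 h _ ≫ M.X ◁ op21 (μ B) W ≫
      op21 M.act W := by
  obtain ⟨sM, φ, ω, hφ, hω, rfl⟩ := hψ
  calc
    _ = op11 ω.inv _ ≫ op21 φ W ≫ op11 ω.hom W := by simp only [op11, op21]; monoidal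
    _ = op12 M.coact _ ≫ op11 sM.p _ ≫ sM.Z ◁ op11 h _ ≫ (op21 (n sM) _ ≫ op21 φ W) ≫
          op11 ω.hom W := by
      rw [op_omega_inv sM _ hh hω]; simp
    _ = op12 M.coact _ ≫ op11 sM.p _ ≫ sM.Z ◁ op11 h _ ≫ sM.Z ◁ op21 (μ B) W ≫
          op21 (n sM) _ ≫ op11 ω.hom W := by
      rw [hφ.op, Category.assoc]
    _ = op12 M.coact _ ≫ (op11 sM.p _ ≫ op11 sM.i _) ≫ M.X ◁ op11 h _ ≫ M.X ◁ op21 (μ B) W ≫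
          op21 M.act W := by
      rw [op_n_omega sM _ hω]; simp
    _ = _ := by rw [op_p_i]

omit [HasCoequalizers C] in
lemma exists_splitting_q [IsIdempotentComplete C] (hh : IsAnchor h) (M : StrongHopfModule h sB) :
    Nonempty (Splitting M.q) :=
  exists_splitting _ (M.isStrong.isHopfModule.coinvEndo_idem hh)

/-- All choices of splitting and of induced structure lead to the same deformed action. -/
lemma existsUnique_deformedAction [IsIdempotentComplete C]
    [PreservesColimitsOfShape WalkingParallelPair (tensorRight B)] (hh : IsAnchor h)
    (h₂ : StrongTwo sB.i) (M : StrongHopfModule h sB) : ∃! ψ, M.IsDeformedAction ψ := by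
  obtain ⟨sM⟩ := M.exists_splitting_q hh
  obtain ⟨φ, hφ, -⟩ := existsUnique_inducedAction sM h₂
  obtain ⟨ω, hω, -⟩ := exists_omega sM hh
  refine ⟨_, ⟨sM, φ, ω, hφ, hω, rfl⟩, fun ψ hψ => ?_⟩
  apply op21_injective
  rw [hψ.op _ hh, IsDeformedAction.op _ hh ⟨sM, φ, ω, hφ, hω, rfl⟩]

lemma isDeformedAction_deformedAct (hψ : ∃! ψ, M.IsDeformedAction ψ) :
    M.IsDeformedAction M.deformedAct := by
  rw [deformedAct, dif_pos hψ.exists]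
  exact hψ.exists.choose_spec

/-- The induced action is its own deformation. -/
lemma op_n_coinv_induced {sM : Splitting M.q} (hh : IsAnchor h) (h₂ : StrongTwo sB.i)
    {φ : tensorObj sM ⊗ B ⟶ tensorObj sM} {ρ : tensorObj sM ⟶ tensorObj sM ⊗ H}
    (hφ : IsInducedAction sM φ) (hρ : IsInducedCoaction sM ρ) :
    op21 (n sM) _ ≫ op12 ρ _ ≫ op11 (coinvEndo h φ ρ) _ ≫ _ ◁ op11 h _ ≫
      tensorObj sM ◁ op21 (μ B) W ≫ op21 φ W = op21 (n sM) _ ≫ op21 φ W := by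
  have hB := hh.isHopfModule
  -- On the tensor product `q` acts through the second factor: `q(m ⊗ b) = m ⊗ q_B(b)`. The claim
  -- thereby reduces to `q(b₀)(h(b₁) c) = (q(b₀) h(b₁)) c = b c` in `B`.
  have hq : ∀ W, op21 (n sM) W ≫ op11 (coinvEndo h φ ρ) W =
      sM.Z ◁ op11 (qB h) W ≫ op21 (n sM) W := by
    intro W
    calc
      _ = (op21 (n sM) W ≫ op12 ρ _) ≫ _ ◁ op11 (anti H) _ ≫
            _ ◁ op11 h _ ≫ op21 φ W := by
        rw [IsHopfModule.op_coinvEndo, Category.assoc]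
      _ = sM.Z ◁ op12 (coactB H B) _ ≫ sM.Z ◁ B ◁ op11 (anti H) _ ≫ sM.Z ◁ B ◁ op11 h _ ≫
            op21 (n sM) _ ≫ op21 φ W := by
        rw [hρ.op]; simp
      _ = _ := by
        rw [hφ.op, IsHopfModule.op_coinvEndo]; simp
  have hq₂ : ∀ W, op11 (qB h) _ ≫ B ◁ op21 (μ B) W ≫ op21 (μ B) W =
      op11 (qB h) _ ≫ op21 (μ B) _ ≫ op21 (μ B) W := by
    intro W
    rw [← op_p_i _ sB, Category.assoc, op_strongTwo h₂, Category.assoc]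
  calc
    _ = (op21 (n sM) _ ≫ op12 ρ _) ≫ op11 (coinvEndo h φ ρ) _ ≫ _ ◁ op11 h _ ≫
          _ ◁ op21 (μ B) W ≫ op21 φ W := by rw [Category.assoc]
    _ = sM.Z ◁ op12 (coactB H B) _ ≫ (op21 (n sM) _ ≫ op11 (coinvEndo h φ ρ) _) ≫
          _ ◁ op11 h _ ≫ _ ◁ op21 (μ B) W ≫ op21 φ W := by
      rw [hρ.op]; simp
    _ = sM.Z ◁ op12 (coactB H B) _ ≫ sM.Z ◁ op11 (qB h) _ ≫ sM.Z ◁ B ◁ op11 h _ ≫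
          sM.Z ◁ B ◁ op21 (μ B) W ≫ op21 (n sM) _ ≫ op21 φ W := by
      rw [hq]; simp
    _ = sM.Z ◁ op12 (coactB H B) _ ≫ sM.Z ◁ B ◁ op11 h _ ≫
          sM.Z ◁ (op11 (qB h) _ ≫ B ◁ op21 (μ B) W ≫ op21 (μ B) W) ≫ op21 (n sM) _ := by
      rw [hφ.op]; simp
    _ = sM.Z ◁ ((op12 (coactB H B) _ ≫ op11 (qB h) _ ≫ B ◁ op11 h _ ≫
          op21 (μ B) _) ≫ op21 (μ B) W) ≫ op21 (n sM) _ := by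
      rw [hq₂]; simp
    _ = _ := by
      rw [hB.op_coinvEndo_act _ hh, hφ.op]; simp

/-- The deformed action of `M` is by construction the transport of `φ` along `ω`, while that of the
tensor product is `φ` itself, so `ω` is quasilinear. Colinearity of `ω` is the formula for `ρ(m b)`
with `m` coinvariant. -/
lemma nonempty_iso_induced [IsIdempotentComplete C]
    [PreservesColimitsOfShape WalkingParallelPair (tensorRight B)] (hh : IsAnchor h)
    (h₂ : StrongTwo sB.i) {sM : Splitting M.q}
    {φ : tensorObj sM ⊗ B ⟶ tensorObj sM} {ρ : tensorObj sM ⟶ tensorObj sM ⊗ H}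
    (hφ : IsInducedAction sM φ) (hρ : IsInducedCoaction sM ρ)
    (hT : IsStrongHopfModule h sB.i φ ρ) :
    Nonempty ((⟨tensorObj sM, φ, ρ, hT⟩ : StrongHopfModule h sB) ≅ M) := by
  obtain ⟨ω, hω, -⟩ := exists_omega sM hh
  have hT' : deformedAct (⟨tensorObj sM, φ, ρ, hT⟩ : StrongHopfModule h sB) = φ := by
    have := epi_op21_n sM B
    have hd := isDeformedAction_deformedAct (existsUnique_deformedAction hh h₂
      (⟨tensorObj sM, φ, ρ, hT⟩ : StrongHopfModule h sB))
    apply op21_injective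
    rw [hd.op _ hh, ← cancel_epi (op21 (n sM) _)]
    exact op_n_coinv_induced _ hh h₂ hφ hρ
  have hM' : M.deformedAct = ω.inv ▷ B ≫ φ ≫ ω.hom :=
    have hu := existsUnique_deformedAction hh h₂ M
    hu.unique (isDeformedAction_deformedAct hu) ⟨sM, φ, ω, hφ, hω, rfl⟩
  have colin : ρ ≫ ω.hom ▷ H = ω.hom ≫ M.coact := by
    have := epi_op21_n_unit sM
    apply op12_injective
    rw [← cancel_epi (op21 (n sM) _)]
    calc
      _ = (op21 (n sM) _ ≫ op12 ρ (𝟙_ C)) ≫ op11 ω.hom _ := by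
        simp only [op21, op11, op12]; monoidal
      _ = sM.Z ◁ op12 (coactB H B) _ ≫ op21 (n sM) _ ≫ op11 ω.hom _ := by
        rw [hρ.op, Category.assoc]
      _ = op11 sM.i _ ≫ op21 M.act _ ≫ op12 M.coact (𝟙_ C) := by
        rw [op_n_omega sM _ hω, op_i_act_coact sM _ hh]; simp
      _ = op21 (n sM) _ ≫ op11 ω.hom _ ≫ op12 M.coact (𝟙_ C) := by
        rw [reassoc_of% op_n_omega sM _ hω]
      _ = _ := by simp only [op11, op12]; monoidal
  have quasi : ω.hom ▷ B ≫ M.deformedAct = φ ≫ ω.hom := by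
    rw [hM', ← comp_whiskerRight_assoc, ω.hom_inv_id]; simp
  exact ⟨{
    hom := Hom.mk ω.hom colin (by rw [hT', quasi])
    inv := Hom.mk ω.inv
      (by rw [Iso.eq_inv_comp, ← reassoc_of% colin, ← comp_whiskerRight]; simp)
      (by rw [hT', hM']; simp)
    hom_inv_id := Hom.ext ω.hom_inv_id
    inv_hom_id := Hom.ext ω.inv_hom_id }⟩

end StrongHopfModule

end WeakHopf

/-- The fundamental theorem of Hopf modules for a weak Hopf quasigroup `H`, a right `H`-comodule
magma `B` and an anchor morphism `h : H ⟶ B`. -/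
theorem theorem2p17 {C : Type u} [Category.{v} C] [MonoidalCategory C] [BraidedCategory C]
    [IsIdempotentComplete C] [HasCoequalizers C]
    (H : C) [WeakHopf.WeakHopfQuasigroup H] (B : C) [WeakHopf.ComoduleMagma H B]
    [PreservesColimitsOfShape WalkingParallelPair (tensorRight B)]
    [PreservesColimitsOfShape WalkingParallelPair (tensorRight H)]
    (h : H ⟶ B) (hh : WeakHopf.IsAnchor h) :
    -- the coinvariants of `B` exist
    Nonempty (WeakHopf.Splitting (WeakHopf.qB h)) ∧
    ∀ sB : WeakHopf.Splitting (WeakHopf.qB h),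
      WeakHopf.StrongOne sB.i → WeakHopf.StrongTwo sB.i →
      ∀ M : WeakHopf.StrongHopfModule h sB,
        -- the deformed action, which enters the definition of the category, is well defined
        (∃! ψ, M.IsDeformedAction ψ) ∧
        -- the coinvariants of `M` exist
        Nonempty (WeakHopf.Splitting M.q) ∧
        ∀ sM : WeakHopf.Splitting M.q,
          -- the action of the coinvariants of `B` on those of `M` is the restriction of that of `B`
          WeakHopf.StrongHopfModule.coinvAct sM ≫ sM.i = (sM.i ⊗ₘ sB.i) ≫ M.act ∧
          -- the induced structure on the tensor product is well defined
          (∃! φ, WeakHopf.StrongHopfModule.IsInducedAction sM φ) ∧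
          (∃! ρ, WeakHopf.StrongHopfModule.IsInducedCoaction sM ρ) ∧
          (∃ ω : WeakHopf.StrongHopfModule.tensorObj sM ≅ M.X,
            WeakHopf.StrongHopfModule.n sM ≫ ω.hom = sM.i ▷ B ≫ M.act) ∧
          -- the tensor product is a strong Hopf module, isomorphic to `M`
          ∀ φ ρ, WeakHopf.StrongHopfModule.IsInducedAction sM φ →
            WeakHopf.StrongHopfModule.IsInducedCoaction sM ρ →
            ∃ hT : WeakHopf.IsStrongHopfModule h sB.i φ ρ,
              Nonempty ((⟨WeakHopf.StrongHopfModule.tensorObj sM, φ, ρ, hT⟩ :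
                WeakHopf.StrongHopfModule h sB) ≅ M) := by
  refine ⟨WeakHopf.exists_splitting _ (hh.isHopfModule.coinvEndo_idem hh), fun sB h₁ h₂ M =>
    ⟨WeakHopf.StrongHopfModule.existsUnique_deformedAction hh h₂ M, M.exists_splitting_q hh,
      fun sM => ⟨WeakHopf.StrongHopfModule.coinvAct_i sM hh,
        WeakHopf.StrongHopfModule.existsUnique_inducedAction sM h₂,
        WeakHopf.StrongHopfModule.existsUnique_inducedCoaction sM hh, ?_, fun φ ρ hφ hρ =>
          ⟨WeakHopf.StrongHopfModule.isStrongHopfModule_induced hh h₁ hφ hρ,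
            WeakHopf.StrongHopfModule.nonempty_iso_induced hh h₂ hφ hρ _⟩⟩⟩⟩
  obtain ⟨ω, hω, -⟩ := WeakHopf.StrongHopfModule.exists_omega sM hh
  exact ⟨ω, hω⟩
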